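/- \textbf{Lions words.} Let $d\ge 1$. A \emph{Lions word} is a triple $W=(w,p_0,P)$ where $w=w_1\cdots w_n$ is a non-empty word in the alphabet $\{1,\dots,d\}$, $p_0$ is a subset of the set $L(w)=\{1,\dots,n\}$ of its letter positions, and $P$ is a partition of $L(w)\setminus p_0$; put $|w|=n$. $\mathscr W$ is the set of Lions words, $\mathscr W_0=\mathscr W\cup\{\mathbf 1\}$ with $\mathbf 1$ the empty word. For $\alpha,\beta>0$ let $\mathscr G_{\alpha,\beta}[W]=\alpha|p_0|+\beta|L(w)\setminus p_0|$, $\gamma=\inf\{\mathscr G_{\alpha,\beta}[W]:W\in\mathscr W,\ \mathscr G_{\alpha,\beta}[W]>1-\alpha\}$, and $\mathscr W_0^{\gamma,\alpha,\beta}=\{W\in\mathscr W_0:\mathscr G_{\alpha,\beta}[W]\le\gamma\}$, $\mathscr W^{\gamma,\alpha,\beta}=\mathscr W_0^{\gamma,\alpha,\beta}\setminus\{\mathbf 1\}$. Operations: $\mathcal E[(w,p_0,P)]=(w,\emptyset,P\cup\{p_0\})$ for $p_0\ne\emptyset$; $\lfloor W\rfloor_i$ appends the letter $i$ and adds its position to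 $p_0$; $W_1\mathbin{\tilde{\sqcup\!\sqcup}}W_2$ is the sum over all shuffles of the two words, the sets $p_0$ being merged and all other blocks kept apart; $W^{i,1}$ and $W^{i,2}$ are the first $i$ and the last $n-i$ letters of $W$ with the traces of $p_0$ and of the blocks of $P$ (empty traces of blocks discarded), $0\le i\le n$. \textbf{Iterated integrals.} Let $C^1=C^1([0,1];\mathbb R^d)$ with norm $\|x\|_1=|x_0|+\sup_s|x'_s|$ and its Borel $\sigma$-field. For $s,t\in[0,1]$, $x\in C^1$ and $y_P=(y_p)_{p\in P}\in (C^1)^P$ let $$\mathcal I^W_{s,t}[x][y_P]=\Big(\int_s^t\int_s^{r_n}\cdots\int_s^{r_2} d\langle z^1_{r_1},e_{w_1}\rangle\cdots d\langle z^n_{r_n},e_{w_n}\rangle\Big)\,e_{w_1}\otimes\cdots\otimes e_{w_n}\in(\mathbb R^d)^{\otimes n},$$ where $z^k=x$ if $k\in p_0$ and $z^k=y_p$ if $k\in p\in P$, and $\mathcal I^{\mathbf 1}=1$. For a probability measure $\mu$ on $C^1$ with support $\mathcal S$, $\mathcal I^{\gamma,\alpha,\beta}_{s,t}=\mathcal I^{\gamma,\alpha,\beta}_{s,t}[\cdot,\mu]$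 denotes the family of the functions $\mathcal I^W_{s,t}$ on $\mathcal S\times\mathcal S^{P}$, $W\in\mathscr W_0^{\gamma,\alpha,\beta}$. \textbf{McKean--Vlasov characters.} Let $(\Omega,\mathbb P)$ be a probability space. A McKean--Vlasov character $f\in G(\mathscr M^{\gamma,\alpha,\beta},L^0(\Omega))$ is a family of measurable functions $\langle f,W\rangle:\Omega\times\Omega^{P}\to(\mathbb R^d)^{\otimes|w|}$, $W\in\mathscr W_0^{\gamma,\alpha,\beta}$, such that almost surely $\langle f,\mathbf 1\rangle=1$; $\langle f,W_1\mathbin{\tilde{\sqcup\!\sqcup}}W_2\rangle=\langle f,W_1\rangle\otimes\langle f,W_2\rangle$ whenever all words involved lie in $\mathscr W_0^{\gamma,\alpha,\beta}$ (tensor factors being identified with the letters they belong to, and the variables being $\omega_0,\omega_{P_1},\omega_{P_2}$); and $\langle f,W\rangle(\omega_{p_0},\omega_P)=\langle f,\mathcal E[W]\rangle(\omega_0,\omega_{p_0},\omega_P)$ whenever $p_0\neq\emptyset$ and $W,\mathcal E[W]\in\mathscr W^{\gamma,\alpha,\beta}$. The convolution product is $$\langle f*g,W\rangle(\omega_0,\omega_P)=\sum_{i=0}^{n}\langle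 f,W^{i,1}\rangle\otimes^P\langle g,W^{i,2}\rangle(\omega_0,\omega_P),$$ where $\otimes^P$ means that each block of $W^{i,1}$ or $W^{i,2}$ carries the variable $\omega_p$ of the block $p\in P$ of which it is the trace. \textbf{Probabilistic rough paths.} A pair $p:\mathscr W_0^{\gamma,\alpha,\beta}\to[1,\infty]$, $q:\mathscr W^{\gamma,\alpha,\beta}\to[1,\infty)$ is a \emph{dual pair} if $\frac1{p[\mathbf 1]}=\frac1{p[W]}+\frac1{q[W]}$ for all $W\in\mathscr W^{\gamma,\alpha,\beta}$ and, for words in $\mathscr W^{\gamma,\alpha,\beta}$, $\frac1{q[W]}\ge\frac1{q[W^{i,1}]}+\frac1{q[W^{i,2}]}$ for $0<i<|w|$, $q[\mathcal E[W]]=q[W]$, and $\frac1{q[V]}=\frac1{q[W_1]}+\frac1{q[W_2]}$ for each word $V$ occurring in $W_1\mathbin{\tilde{\sqcup\!\sqcup}}W_2$. Given a dual pair $(p,q)$, a family $\mathbf X_{s,t}$, $s,t\in[0,1]$, of McKean--Vlasov characters is an $(\mathscr M^{\gamma,\alpha,\beta},p,q)$-\emph{probabilistic rough path} if $\mathbb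 E|\langle\mathbf X_{s,t},W\rangle|^{q[W]}<\infty$ for $W\in\mathscr W^{\gamma,\alpha,\beta}$; almost surely $\mathbf X_{s,t}*\mathbf X_{t,u}=\mathbf X_{s,u}$ on $\mathscr W_0^{\gamma,\alpha,\beta}$ for all $s,t,u\in[0,1]$; if $p_0\ne\emptyset$, $$\mathbb E^0\Big[\sup_{s\ne t}\frac{\mathbb E^{P}\big[|\langle\mathbf X_{s,t},W\rangle(\omega_0,\omega_P)|^{q[W]}\big]}{|t-s|^{q[W]\mathscr G_{\alpha,\beta}[W]}}\Big]<\infty ;$$ and if $p_0=\emptyset$ there is $C_W>0$ such that for all $s,t$, almost surely in $\omega_0$, $\mathbb E^{P}\big[|\langle\mathbf X_{s,t},W\rangle|^{q[W]}\big]^{1/q[W]}\le C_W|t-s|^{\mathscr G_{\alpha,\beta}[W]}$. \textbf{Proposition.} Let $\alpha,\beta>0$, let $\gamma$ be as above, let $q'\ge\lfloor\gamma/(\alpha\wedge\beta)\rfloor$, let $\mu$ be a probability measure on $C^1$ with $\int\|x\|_1^{q'}\,d\mu(x)<\infty$, and let $\mathcal S=\operatorname{supp}\mu$. Then: (1) The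 iterated integrals satisfy, for all $s,t\in[0,1]$ and all arguments in $C^1$, $\mathcal I^{(i,\{i\},\emptyset)}_{s,t}[x]=\langle x_{t}-x_s,e_i\rangle e_i$; $\mathcal I^{W_1\mathbin{\tilde{\sqcup\!\sqcup}}W_2}_{s,t}[x][y_{P_1},y_{P_2}]=\mathcal I^{W_1}_{s,t}[x][y_{P_1}]\otimes\mathcal I^{W_2}_{s,t}[x][y_{P_2}]$; $\mathcal I^{\mathcal E[W]}_{s,t}[x][y_{p_0},y_P]=\mathcal I^{W}_{s,t}[y_{p_0}][y_P]$ for $p_0\neq\emptyset$; $\mathcal I^{\lfloor W\rfloor_i}_{s,t}[x][y_P]=\int_s^t\mathcal I^W_{s,r}[x][y_P]\otimes d(\langle x_r,e_i\rangle e_i)$. (2) For all $s,t\in[0,1]$, $\mathcal I^{\gamma,\alpha,\beta}_{s,t}$ belongs to $G(\mathscr M^{\gamma,\alpha,\beta},L^0(\mathcal S,\mu))$. (3) For all $s,t,u\in[0,1]$ and every $x\in\mathcal S$ (and every value of the free variables in $\mathcal S$), $\mathcal I^{\gamma,\alpha,\beta}_{s,t}[x,\mu]*\mathcal I^{\gamma,\alpha,\beta}_{t,u}[x,\mu]=\mathcal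 I^{\gamma,\alpha,\beta}_{s,u}[x,\mu]$. (4) With $q[W]=q'/|w|$ there is $p$ such that $(p,q)$ is a dual pair, and if $\alpha\wedge\beta\le1$ then, for every such $p$, $\mathcal I^{\gamma,\alpha,\beta}$ is an $(\mathscr M^{\gamma,\alpha,\beta},p,q)$-probabilistic rough path over the probability space $(\mathcal S,\mu)$. -/

import Mathlib

open MeasureTheory Set Finset
open scoped ENNReal

noncomputable section

/-! ### Lions words -/

/-- A Lions word `(w, p₀, P)` over the alphabet `{1, …, d}`: a word `w` of length `len`, a set `p₀`
of (positions of) letters, and a partition `P` of the remaining letters. The unique word of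
length `0` is the unit `𝟏`; the words with `len ≠ 0` are the genuine Lions words. -/
structure LionsWord (d : ℕ) where
  len : ℕ
  letter : Fin len → Fin d
  p0 : Finset (Fin len)
  P : Finpartition (p0ᶜ)

namespace LionsWord

variable {d : ℕ}

/-- The index set of the free variables: the blocks of the partition `P`. -/
abbrev Block (W : LionsWord d) : Type := {p : Finset (Fin W.len) // p ∈ W.P.parts}

/-- The grading `𝒢_{α,β}[W] = α |p₀| + β |L(w) \ p₀|`. -/
def grade (α β : ℝ) (W : LionsWord d) : ℝ := α * (#W.p0 : ℝ) + β * (#(W.p0ᶜ) : ℝ)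

/-- The empty word `𝟏`. -/
def one (d : ℕ) : LionsWord d where
  len := 0
  letter := Fin.elim0
  p0 := ∅
  P := Finpartition.ofExistsUnique ∅ (by simp) (fun a => a.elim0) (by simp)

/-- The one-letter word `(i, {i}, ∅)`. -/
def single (i : Fin d) : LionsWord d where
  len := 1
  letter := fun _ => i
  p0 := Finset.univ
  P := Finpartition.ofExistsUnique ∅ (by simp) (by simp) (by simp)

/-- The Lions word read off along an injection `e` of positions: the `k`-th letter is the
`e k`-th letter of `W`, and `p₀`, `P` are restricted accordingly (empty traces of blocks being
discarded). For a bijection `e` this permutes the letters, together with their hyperedges. -/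
def sub (W : LionsWord d) {m : ℕ} (e : Fin m ↪ Fin W.len) : LionsWord d where
  len := m
  letter := fun k => W.letter (e k)
  p0 := Finset.univ.filter (fun k => e k ∈ W.p0)
  P := Finpartition.ofExistsUnique
    ((W.P.parts.image (fun p => Finset.univ.filter (fun k => e k ∈ p))).erase ∅)
    (by
      intro q hq k hk
      obtain ⟨-, hq⟩ := Finset.mem_erase.1 hq
      obtain ⟨p, hp, rfl⟩ := Finset.mem_image.1 hq
      have h1 : e k ∈ p := (Finset.mem_filter.1 hk).2
      have h2 := W.P.le hp h1
      simpa using h2)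
    (by
      intro k hk
      have hk' : e k ∈ (W.p0)ᶜ := by simpa using hk
      obtain ⟨p, hp, hkp⟩ := W.P.exists_mem hk'
      refine ⟨Finset.univ.filter (fun k => e k ∈ p), ⟨?_, by simpa using hkp⟩, ?_⟩
      · refine Finset.mem_erase.2 ⟨?_, Finset.mem_image_of_mem _ hp⟩
        exact Finset.ne_empty_of_mem (a := k) (by simpa using hkp)
      · rintro q ⟨hq, hkq⟩
        obtain ⟨p', hp', rfl⟩ := Finset.mem_image.1 (Finset.mem_erase.1 hq).2
        have hkp' : e k ∈ p' := (Finset.mem_filter.1 hkq).2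
        rw [W.P.eq_of_mem_parts hp' hp hkp' hkp])
    (by simp)

theorem sub_exists (W : LionsWord d) {m : ℕ} (e : Fin m ↪ Fin W.len) (q : (W.sub e).Block) :
    ∃ p : W.Block, Finset.univ.filter (fun k => e k ∈ p.1) = q.1 := by
  obtain ⟨p, hp, h⟩ := Finset.mem_image.1 (Finset.mem_erase.1 q.2).2
  exact ⟨⟨p, hp⟩, h⟩

/-- The map `ψ` sending a block of a restricted word to the unique block of `W` of which it is
the trace. -/
def psi (W : LionsWord d) {m : ℕ} (e : Fin m ↪ Fin W.len) (q : (W.sub e).Block) : W.Block :=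
  (W.sub_exists e q).choose

theorem psi_spec (W : LionsWord d) {m : ℕ} (e : Fin m ↪ Fin W.len) (q : (W.sub e).Block) :
    Finset.univ.filter (fun k => e k ∈ (W.psi e q).1) = q.1 :=
  (W.sub_exists e q).choose_spec

/-- Positions of the first `i` letters of a word of length `n`. -/
def headEmb {n : ℕ} (i : Fin (n + 1)) : Fin (i : ℕ) ↪ Fin n :=
  Fin.castLEEmb (Nat.lt_succ_iff.1 i.2)

/-- Positions of the last `n - i` letters of a word of length `n`. -/
def tailEmb {n : ℕ} (i : Fin (n + 1)) : Fin (n - (i : ℕ)) ↪ Fin n where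
  toFun k := ⟨(i : ℕ) + k, by have := k.2; omega⟩
  inj' a b h := by
    have := congrArg Fin.val h
    ext
    simpa using this

/-- `W^{i,1}`: the left factor of the deconcatenation of `W` after the `i`-th letter. -/
def head (W : LionsWord d) (i : Fin (W.len + 1)) : LionsWord d := W.sub (headEmb i)

/-- `W^{i,2}`: the right factor of the deconcatenation of `W` after the `i`-th letter. -/
def tail (W : LionsWord d) (i : Fin (W.len + 1)) : LionsWord d := W.sub (tailEmb i)

theorem castAdd_mem {m n : ℕ} (a : Fin m) (p : Finset (Fin m)) :
    Fin.castAdd n a ∈ p.map (Fin.castAddEmb n) ↔ a ∈ p :=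
  Finset.mem_map' (Fin.castAddEmb n)

theorem natAdd_mem {m n : ℕ} (a : Fin n) (p : Finset (Fin n)) :
    Fin.natAdd m a ∈ p.map (Fin.natAddEmb m) ↔ a ∈ p :=
  Finset.mem_map' (Fin.natAddEmb m)

theorem natAdd_notMem {m n : ℕ} (a : Fin n) (p : Finset (Fin m)) :
    Fin.natAdd m a ∉ p.map (Fin.castAddEmb n) := by
  intro h
  obtain ⟨b, -, hb⟩ := Finset.mem_map.1 h
  have h1 := congrArg Fin.val hb
  have h2 := b.2
  simp at h1
  omega

theorem castAdd_notMem {m n : ℕ} (a : Fin m) (p : Finset (Fin n)) :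
    Fin.castAdd n a ∉ p.map (Fin.natAddEmb m) := by
  intro h
  obtain ⟨b, -, hb⟩ := Finset.mem_map.1 h
  have h1 := congrArg Fin.val hb
  have h2 := a.2
  simp at h1
  omega

/-- Concatenation of two Lions words: the sets `p₀` are merged, and the blocks of the two
partitions are kept distinct. -/
def concat (W₁ W₂ : LionsWord d) : LionsWord d where
  len := W₁.len + W₂.len
  letter := Fin.append W₁.letter W₂.letter
  p0 := W₁.p0.map (Fin.castAddEmb W₂.len) ∪ W₂.p0.map (Fin.natAddEmb W₁.len)
  P := Finpartition.ofExistsUnique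
    (W₁.P.parts.image (fun p => p.map (Fin.castAddEmb W₂.len)) ∪
      W₂.P.parts.image (fun p => p.map (Fin.natAddEmb W₁.len)))
    (by
      intro q hq k hk
      rcases Finset.mem_union.1 hq with hq | hq <;> obtain ⟨p, hp, rfl⟩ := Finset.mem_image.1 hq <;>
        obtain ⟨a, ha, rfl⟩ := Finset.mem_map.1 hk
      · have h := Finset.mem_compl.1 (W₁.P.le hp ha)
        rw [Finset.mem_compl, Finset.mem_union, not_or]
        exact ⟨fun h' => h ((castAdd_mem a _).1 h'), castAdd_notMem a _⟩
      · have h := Finset.mem_compl.1 (W₂.P.le hp ha)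
        rw [Finset.mem_compl, Finset.mem_union, not_or]
        exact ⟨natAdd_notMem a _, fun h' => h ((natAdd_mem a _).1 h')⟩)
    (by
      intro k hk
      rw [Finset.mem_compl, Finset.mem_union, not_or] at hk
      induction k using Fin.addCases with
      | left a =>
        have ha : a ∈ (W₁.p0)ᶜ := Finset.mem_compl.2 fun h => hk.1 ((castAdd_mem a _).2 h)
        obtain ⟨p, hp, hap⟩ := W₁.P.exists_mem ha
        refine ⟨p.map (Fin.castAddEmb W₂.len), ⟨Finset.mem_union_left _
          (Finset.mem_image_of_mem _ hp), (castAdd_mem a _).2 hap⟩, ?_⟩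
        rintro q ⟨hq, hkq⟩
        rcases Finset.mem_union.1 hq with hq | hq <;> obtain ⟨p', hp', rfl⟩ := Finset.mem_image.1 hq
        · rw [W₁.P.eq_of_mem_parts hp' hp ((castAdd_mem a _).1 hkq) hap]
        · exact absurd hkq (castAdd_notMem a _)
      | right a =>
        have ha : a ∈ (W₂.p0)ᶜ := Finset.mem_compl.2 fun h => hk.2 ((natAdd_mem a _).2 h)
        obtain ⟨p, hp, hap⟩ := W₂.P.exists_mem ha
        refine ⟨p.map (Fin.natAddEmb W₁.len), ⟨Finset.mem_union_right _
          (Finset.mem_image_of_mem _ hp), (natAdd_mem a _).2 hap⟩, ?_⟩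
        rintro q ⟨hq, hkq⟩
        rcases Finset.mem_union.1 hq with hq | hq <;> obtain ⟨p', hp', rfl⟩ := Finset.mem_image.1 hq
        · exact absurd hkq (natAdd_notMem a _)
        · rw [W₂.P.eq_of_mem_parts hp' hp ((natAdd_mem a _).1 hkq) hap])
    (by
      intro h
      rcases Finset.mem_union.1 h with h | h <;> obtain ⟨p, hp, h'⟩ := Finset.mem_image.1 h <;>
        rw [Finset.map_eq_empty] at h'
      · exact W₁.P.ne_empty hp h'
      · exact W₂.P.ne_empty hp h')

/-- The blocks of the first factor among those of the concatenation. -/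
def inl (W₁ W₂ : LionsWord d) (p : W₁.Block) : (W₁.concat W₂).Block :=
  ⟨p.1.map (Fin.castAddEmb W₂.len),
    Finset.mem_union_left _ (Finset.mem_image_of_mem
      (fun q : Finset (Fin W₁.len) => q.map (Fin.castAddEmb W₂.len)) p.2)⟩

/-- The blocks of the second factor among those of the concatenation. -/
def inr (W₁ W₂ : LionsWord d) (p : W₂.Block) : (W₁.concat W₂).Block :=
  ⟨p.1.map (Fin.natAddEmb W₁.len),
    Finset.mem_union_right _ (Finset.mem_image_of_mem
      (fun q : Finset (Fin W₂.len) => q.map (Fin.natAddEmb W₁.len)) p.2)⟩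

/-- The grafting operator `⌊W⌋ᵢ`: the letter `i` is appended to the word and added to `p₀`. -/
def graft (W : LionsWord d) (i : Fin d) : LionsWord d := W.concat (single i)

/-- The operator `ℰ[(w, p₀, P)] = (w, ∅, P ∪ {p₀})` (an empty `p₀` being discarded). -/
def E (W : LionsWord d) : LionsWord d where
  len := W.len
  letter := W.letter
  p0 := ∅
  P := Finpartition.ofExistsUnique ((insert W.p0 W.P.parts).erase ∅)
    (by simp)
    (by
      intro k _
      by_cases hk : k ∈ W.p0
      · refine ⟨W.p0, ⟨Finset.mem_erase.2 ⟨Finset.ne_empty_of_mem hk,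
          Finset.mem_insert_self _ _⟩, hk⟩, ?_⟩
        rintro q ⟨hq, hkq⟩
        rcases Finset.mem_insert.1 (Finset.mem_erase.1 hq).2 with h | h
        · exact h
        · exact absurd hk (Finset.mem_compl.1 (W.P.le h hkq))
      · obtain ⟨p, hp, hkp⟩ := W.P.exists_mem (Finset.mem_compl.2 hk)
        refine ⟨p, ⟨Finset.mem_erase.2 ⟨Finset.ne_empty_of_mem hkp,
          Finset.mem_insert_of_mem hp⟩, hkp⟩, ?_⟩
        rintro q ⟨hq, hkq⟩
        rcases Finset.mem_insert.1 (Finset.mem_erase.1 hq).2 with h | h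
        · exact absurd (h ▸ hkq) hk
        · exact W.P.eq_of_mem_parts h hp hkq hkp)
    (by simp)

/-- The block `p₀` of `ℰ[W]`. -/
def tagBlock (W : LionsWord d) (h : W.p0 ≠ ∅) : W.E.Block :=
  ⟨W.p0, Finset.mem_erase.2 ⟨h, Finset.mem_insert_self _ _⟩⟩

/-- The blocks of `W` as blocks of `ℰ[W]`. -/
def oldBlock (W : LionsWord d) (p : W.Block) : W.E.Block :=
  ⟨p.1, Finset.mem_erase.2 ⟨W.P.ne_empty p.2, Finset.mem_insert_of_mem p.2⟩⟩

/-- The truncated set `𝒲₀^{γ,α,β}` of Lions words (with `𝟏`) of grade at most `γ`. -/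
def trunc (d : ℕ) (α β γ : ℝ) : Set (LionsWord d) := {W | W.grade α β ≤ γ}

/-- `γ = inf {𝒢_{α,β}[W] : W ∈ 𝒲, 𝒢_{α,β}[W] > 1 - α}`. -/
def critGrade (d : ℕ) (α β : ℝ) : ℝ :=
  sInf {r | ∃ W : LionsWord d, W.len ≠ 0 ∧ 1 - α < W.grade α β ∧ W.grade α β = r}

/-- The shuffles of a word of length `m` with a word of length `n`: the `k`-th letter of the
shuffled word is the letter number `σ k` of the concatenation, and the letters of each of the two
words keep their order. -/
def shuffles (m n : ℕ) : Finset (Equiv.Perm (Fin (m + n))) :=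
  open Classical in Finset.univ.filter fun σ =>
    StrictMono (fun a : Fin m => σ.symm (Fin.castAdd n a)) ∧
      StrictMono (fun a : Fin n => σ.symm (Fin.natAdd m a))

/-- The term of the shuffle product `W₁ ⧢ W₂ = ∑_σ W₁ ⧢_σ W₂` belonging to the shuffle `σ`. -/
abbrev shuffleTerm (W₁ W₂ : LionsWord d) (σ : Equiv.Perm (Fin (W₁.len + W₂.len))) : LionsWord d :=
  (W₁.concat W₂).sub (m := W₁.len + W₂.len) σ.toEmbedding

end LionsWord

/-! ### Tensors -/

/-- The tensor space `(ℝ^d)^{⊗ n}` with its Euclidean norm, in coordinates with respect to the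
basis `e_{j 1} ⊗ ⋯ ⊗ e_{j n}`. -/
abbrev Tens (d n : ℕ) : Type := EuclideanSpace ℝ (Fin n → Fin d)

/-- The tensor product `A ⊗ B`, with the factors of `A` placed at the positions `e₁` and those of
`B` at the positions `e₂`. -/
def tensorAt {d a b n : ℕ} (e₁ : Fin a → Fin n) (e₂ : Fin b → Fin n) (A : Tens d a) (B : Tens d b) :
    Tens d n :=
  WithLp.toLp 2 fun j => A (j ∘ e₁) * B (j ∘ e₂)

/-- The tensor whose factor at position `σ k` is the factor of `T` at position `k`. -/
def reorder {d n : ℕ} (σ : Equiv.Perm (Fin n)) (T : Tens d n) : Tens d n :=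
  WithLp.toLp 2 fun j => T (j ∘ σ)

/-! ### The dual module, the convolution product and McKean–Vlasov characters -/

section Dual

variable {d : ℕ} {Ω : Type*}

/-- Families `(⟨f, W⟩)_W` of tensor valued functions `⟨f, W⟩ (ω₀, ω_P)` indexed by Lions words. -/
abbrev DualElt (d : ℕ) (Ω : Type*) : Type _ :=
  ∀ W : LionsWord d, Ω × (W.Block → Ω) → Tens d W.len

/-- The term `⟨f, W^{i,1}⟩ ⊗^P ⟨g, W^{i,2}⟩`: the two factors are coupled through the partition
`P` of `W`, that is, traces of the same block of `P` carry the same variable. -/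
def coupledTerm (f g : DualElt d Ω) (W : LionsWord d) (i : Fin (W.len + 1))
    (ω : Ω × (W.Block → Ω)) : Tens d W.len :=
  tensorAt (LionsWord.headEmb i) (LionsWord.tailEmb i)
    (f (W.head i) (ω.1, fun p => ω.2 (W.psi (LionsWord.headEmb i) p)))
    (g (W.tail i) (ω.1, fun p => ω.2 (W.psi (LionsWord.tailEmb i) p)))

/-- The convolution product `f * g` dual to the coupled deconcatenation coproduct
`Δ[W] = ∑_{i=0}^n W^{i,1} ×^P W^{i,2}`, truncated at grade `γ`. -/
def conv (α β γ : ℝ) (f g : DualElt d Ω) : DualElt d Ω := fun W ω =>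
  open Classical in
  if W ∈ LionsWord.trunc d α β γ then ∑ i : Fin (W.len + 1), coupledTerm f g W i ω else 0

variable [MeasurableSpace Ω]

/-- The measure `ℙ × ℙ^{× |P|}` on `Ω × Ω^{× |P|}`. -/
def blockMeasure (ℙ : Measure Ω) (W : LionsWord d) : Measure (Ω × (W.Block → Ω)) :=
  ℙ.prod (Measure.pi fun _ => ℙ)

/-- Elements of `G(𝓜^{γ,α,β}, L⁰)`, the McKean–Vlasov characters. -/
structure IsMcKeanVlasovCharacter (α β γ : ℝ) (ℙ : Measure Ω) (f : DualElt d Ω) : Prop where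
  /-- `f` is an element of the dual module of measurable functions, truncated at grade `γ` -/
  measurable : ∀ W, Measurable (f W)
  eq_zero : ∀ W, W ∉ LionsWord.trunc d α β γ → f W = 0
  /-- `⟨f, 𝟏⟩ = 1` -/
  map_one : ∀ᵐ ω ∂(blockMeasure ℙ (LionsWord.one d)),
    f (LionsWord.one d) ω = EuclideanSpace.single Fin.elim0 1
  /-- `⟨f, W₁ ⧢ W₂⟩ = ⟨f, W₁⟩ ⊗ ⟨f, W₂⟩` -/
  map_shuffle : ∀ W₁ W₂ : LionsWord d, W₁.concat W₂ ∈ LionsWord.trunc d α β γ →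
    ∀ᵐ ω ∂(blockMeasure ℙ (W₁.concat W₂)),
      ∑ σ ∈ LionsWord.shuffles W₁.len W₂.len,
        reorder σ (f (W₁.shuffleTerm W₂ σ) (ω.1, fun p => ω.2 ((W₁.concat W₂).psi _ p))) =
      tensorAt (Fin.castAdd W₂.len) (Fin.natAdd W₁.len)
        (f W₁ (ω.1, fun p => ω.2 (W₁.inl W₂ p))) (f W₂ (ω.1, fun p => ω.2 (W₁.inr W₂ p)))
  /-- `⟨f, W⟩(ω_{p₀}, ω_P) = ⟨f, ℰ[W]⟩(ω₀, ω_{p₀}, ω_P)` -/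
  map_E : ∀ (W : LionsWord d) (h : W.p0 ≠ ∅), W ∈ LionsWord.trunc d α β γ →
    W.E ∈ LionsWord.trunc d α β γ →
    ∀ᵐ ω ∂(blockMeasure ℙ W.E),
      f W (ω.2 (W.tagBlock h), fun p => ω.2 (W.oldBlock p)) = f W.E ω

/-! ### Probabilistic rough paths -/

/-- Dual pairs `(p, q)` of integrability functionals on `𝒲^{γ,α,β}`; the value `∞` is allowed
for `p`, with `1 / ∞ = 0`. -/
structure IsDualPair (d : ℕ) (α β γ : ℝ) (p : LionsWord d → ℝ≥0∞) (q : LionsWord d → ℝ) :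
    Prop where
  one_le_p : ∀ W ∈ LionsWord.trunc d α β γ, 1 ≤ p W
  one_le_q : ∀ W ∈ LionsWord.trunc d α β γ, W.len ≠ 0 → 1 ≤ q W
  conj : ∀ W ∈ LionsWord.trunc d α β γ, W.len ≠ 0 →
    (p (LionsWord.one d))⁻¹ = (p W)⁻¹ + (ENNReal.ofReal (q W))⁻¹
  coproduct : ∀ W ∈ LionsWord.trunc d α β γ, ∀ i : Fin (W.len + 1),
    (W.head i).len ≠ 0 → (W.tail i).len ≠ 0 →
      1 / q (W.head i) + 1 / q (W.tail i) ≤ 1 / q W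
  map_E : ∀ W ∈ LionsWord.trunc d α β γ, W.E ∈ LionsWord.trunc d α β γ → W.len ≠ 0 →
    q W.E = q W
  shuffle : ∀ W₁ W₂ : LionsWord d, W₁.len ≠ 0 → W₂.len ≠ 0 →
    W₁.concat W₂ ∈ LionsWord.trunc d α β γ → ∀ σ ∈ LionsWord.shuffles W₁.len W₂.len,
      1 / q (W₁.shuffleTerm W₂ σ) = 1 / q W₁ + 1 / q W₂

/-- The conditional moment `𝔼^P[|⟨f, W⟩(ω₀, ω_P)|^r]`, as a function of `ω₀`. -/
def condMoment (ℙ : Measure Ω) (f : DualElt d Ω) (W : LionsWord d) (r : ℝ) (ω₀ : Ω) : ℝ≥0∞ :=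
  ∫⁻ ω, ‖f W (ω₀, ω)‖ₑ ^ r ∂(Measure.pi fun _ : W.Block => ℙ)

/-- The two-parameter family `X` is an `(𝓜^{γ,α,β}, p, q)`-probabilistic rough path. -/
structure IsProbabilisticRoughPath (α β γ : ℝ) (p : LionsWord d → ℝ≥0∞) (q : LionsWord d → ℝ)
    (ℙ : Measure Ω) [IsProbabilityMeasure ℙ] (X : unitInterval → unitInterval → DualElt d Ω) : Prop where
  dual : IsDualPair d α β γ p q
  /-- the increments are McKean–Vlasov characters … -/
  character : ∀ s t, IsMcKeanVlasovCharacter α β γ ℙ (X s t)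
  /-- … of finite dual norm `‖·‖_𝐪` -/
  moment : ∀ s t, ∀ W ∈ LionsWord.trunc d α β γ, W.len ≠ 0 →
    MemLp (X s t W) (ENNReal.ofReal (q W)) (blockMeasure ℙ W)
  /-- the coupled Chen relation -/
  chen : ∀ s t u, ∀ W ∈ LionsWord.trunc d α β γ,
    conv α β γ (X s t) (X t u) W =ᵐ[blockMeasure ℙ W] X s u W
  /-- regularity of the components that carry the tagged variable -/
  regular_tagged : ∀ W ∈ LionsWord.trunc d α β γ, W.p0 ≠ ∅ →
    AEMeasurable (fun ω₀ => ⨆ (s : unitInterval) (t : unitInterval) (_ : s ≠ t),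
      condMoment ℙ (X s t) W (q W) ω₀ /
        ENNReal.ofReal (|(t : ℝ) - s| ^ (q W * W.grade α β))) ℙ ∧
    ∫⁻ ω₀, (⨆ (s : unitInterval) (t : unitInterval) (_ : s ≠ t),
      condMoment ℙ (X s t) W (q W) ω₀ /
        ENNReal.ofReal (|(t : ℝ) - s| ^ (q W * W.grade α β))) ∂ℙ < ∞
  /-- regularity of the components that do not carry the tagged variable -/
  regular_untagged : ∀ W ∈ LionsWord.trunc d α β γ, W.len ≠ 0 → W.p0 = ∅ →
    ∃ C : ℝ, 0 < C ∧ ∀ s t : unitInterval, ∀ᵐ ω₀ ∂ℙ,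
      condMoment ℙ (X s t) W (q W) ω₀ ^ (1 / q W) ≤
        ENNReal.ofReal (C * |(t : ℝ) - s| ^ W.grade α β)

end Dual

/-! ### Continuously differentiable paths -/

/-- The vector space of continuously differentiable paths `x : [0,1] → ℝ^d`. -/
def c1Submodule (d : ℕ) : Submodule ℝ C(unitInterval, EuclideanSpace ℝ (Fin d)) where
  carrier := {x | ContDiffOn ℝ 1 (Set.IccExtend zero_le_one x) (Icc (0 : ℝ) 1)}
  add_mem' {x y} hx hy := ContDiffOn.add (f := Set.IccExtend zero_le_one (⇑x))
    (g := Set.IccExtend zero_le_one (⇑y)) hx hy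
  zero_mem' := contDiffOn_const (c := (0 : EuclideanSpace ℝ (Fin d)))
  smul_mem' c x hx := ContDiffOn.const_smul (f := Set.IccExtend zero_le_one (⇑x)) c hx

/-- The space `C¹([0,1]; ℝ^d)`. -/
def C1Path (d : ℕ) : Type := c1Submodule d

namespace C1Path

variable {d : ℕ}

instance : AddCommGroup (C1Path d) := inferInstanceAs (AddCommGroup (c1Submodule d))

instance : Module ℝ (C1Path d) := inferInstanceAs (Module ℝ (c1Submodule d))

/-- The path as a function on the real line, constant outside `[0,1]`. -/
def path (x : C1Path d) : ℝ → EuclideanSpace ℝ (Fin d) :=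
  Set.IccExtend zero_le_one (x : c1Submodule d).1

/-- The derivative `x'` of the path on `[0,1]` (one-sided at the end points). -/
def vel (x : C1Path d) (r : ℝ) : EuclideanSpace ℝ (Fin d) := derivWithin x.path (Icc 0 1) r

theorem contDiffOn (x : C1Path d) : ContDiffOn ℝ 1 x.path (Icc 0 1) := (x : c1Submodule d).2

theorem path_add (x y : C1Path d) : (x + y).path = x.path + y.path := rfl

theorem path_neg (x : C1Path d) : (-x).path = -x.path := rfl

theorem path_zero : (0 : C1Path d).path = 0 := rfl

theorem continuousOn_vel (x : C1Path d) : ContinuousOn x.vel (Icc 0 1) :=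
  x.contDiffOn.continuousOn_derivWithin (uniqueDiffOn_Icc zero_lt_one) le_rfl

theorem bddAbove_vel (x : C1Path d) : BddAbove (Set.range fun r : unitInterval => ‖x.vel r‖) := by
  have h : Continuous fun r : unitInterval => ‖x.vel r‖ := by
    have := x.continuousOn_vel
    rw [continuousOn_iff_continuous_domRestrict] at this
    exact this.norm
  exact (isCompact_range h).bddAbove

theorem vel_add (x y : C1Path d) (r : unitInterval) : (x + y).vel r = x.vel r + y.vel r :=
  derivWithin_add ((x.contDiffOn.differentiableOn one_ne_zero) _ r.2)
    ((y.contDiffOn.differentiableOn one_ne_zero) _ r.2)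

theorem vel_neg (x : C1Path d) (r : ℝ) : (-x).vel r = -x.vel r := by
  simp only [vel, path_neg]
  exact derivWithin.neg

/-- The norm `‖x‖₁ = |x₀| + sup_{s ∈ [0,1]} |x'_s|`. -/
instance : NormedAddCommGroup (C1Path d) :=
  AddGroupNorm.toNormedAddCommGroup
    { toFun := fun x => ‖x.path 0‖ + ⨆ r : unitInterval, ‖x.vel r‖
      map_zero' := by
        have h : ∀ r : ℝ, (0 : C1Path d).vel r = 0 := fun r => by simp [vel, path_zero]
        simp [h, path_zero]
      add_le' := fun x y => by
        have h1 : ‖(x + y).path 0‖ ≤ ‖x.path 0‖ + ‖y.path 0‖ := norm_add_le _ _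
        have h2 : ⨆ r : unitInterval, ‖(x + y).vel r‖ ≤ (⨆ r : unitInterval, ‖x.vel r‖) + ⨆ r : unitInterval, ‖y.vel r‖ :=
          ciSup_le fun r => by
            rw [vel_add]
            exact (norm_add_le _ _).trans
              (add_le_add (le_ciSup x.bddAbove_vel r) (le_ciSup y.bddAbove_vel r))
        linarith
      neg' := fun x => by simp [vel_neg, path_neg]
      eq_zero_of_map_eq_zero' := fun x h => by
        have h0 : 0 ≤ ⨆ r : unitInterval, ‖x.vel r‖ := Real.iSup_nonneg fun _ => norm_nonneg _
        have hx0 : x.path 0 = 0 := by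
          rw [← norm_eq_zero]; linarith [norm_nonneg (x.path 0)]
        have hs : ⨆ r : unitInterval, ‖x.vel r‖ = 0 := by linarith [norm_nonneg (x.path 0)]
        have hv : ∀ r ∈ Ico (0 : ℝ) 1, derivWithin x.path (Icc 0 1) r = 0 := fun r hr => by
          rw [← norm_eq_zero]
          refine le_antisymm ?_ (norm_nonneg _)
          exact (le_ciSup x.bddAbove_vel ⟨r, hr.1, hr.2.le⟩).trans hs.le
        have hc := constant_of_derivWithin_zero (x.contDiffOn.differentiableOn one_ne_zero) hv
        have key : ∀ r : unitInterval, (x : c1Submodule d).1 r = 0 := fun r => by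
          have := (hc r r.2).trans hx0
          rwa [path, Set.IccExtend_val] at this
        exact Subtype.ext (ContinuousMap.ext key) }

theorem norm_def (x : C1Path d) : ‖x‖ = ‖x.path 0‖ + ⨆ r : unitInterval, ‖x.vel r‖ := rfl

/-- The Borel `σ`-field of the norm topology. -/
instance : MeasurableSpace (C1Path d) := borel _

instance : BorelSpace (C1Path d) := ⟨rfl⟩

/-- The derivative as a continuous function on `[0,1]`. -/
def velC (x : C1Path d) : C(unitInterval, EuclideanSpace ℝ (Fin d)) where
  toFun r := x.vel r
  continuous_toFun := continuousOn_iff_continuous_domRestrict.1 x.continuousOn_vel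

instance : SecondCountableTopology (C1Path d) := by
  let Φ : C1Path d → EuclideanSpace ℝ (Fin d) × C(unitInterval, EuclideanSpace ℝ (Fin d)) :=
    fun x => (x.path 0, x.velC)
  have hdist : ∀ x y : C1Path d, dist x y =
      ‖x.path 0 - y.path 0‖ + ⨆ r : unitInterval, ‖x.vel r - y.vel r‖ := by
    intro x y
    have h : ∀ r : unitInterval, (x - y).vel r = x.vel r - y.vel r := fun r => by
      rw [sub_eq_add_neg, vel_add, vel_neg, sub_eq_add_neg]
    have h0 : (x - y).path 0 = x.path 0 - y.path 0 := rfl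
    rw [dist_eq_norm, norm_def, h0]
    simp only [h]
  have hle : ∀ x y : C1Path d, ∀ r : unitInterval, ‖x.vel r - y.vel r‖ ≤ dist x.velC y.velC :=
    fun x y r => by rw [← dist_eq_norm]; exact ContinuousMap.dist_apply_le_dist (f := x.velC) (g := y.velC) r
  have hanti : AntilipschitzWith 2 Φ := AntilipschitzWith.of_le_mul_dist fun x y => by
    have h1 : ‖x.path 0 - y.path 0‖ ≤ dist (Φ x) (Φ y) := by
      rw [← dist_eq_norm]; exact le_max_left _ _
    have h2 : ⨆ r : unitInterval, ‖x.vel r - y.vel r‖ ≤ dist (Φ x) (Φ y) :=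
      ciSup_le fun r => (hle x y r).trans (le_max_right _ _)
    rw [hdist]
    push_cast
    linarith
  have hlip : LipschitzWith 1 Φ := LipschitzWith.of_dist_le_mul fun x y => by
    have h0 : 0 ≤ ⨆ r : unitInterval, ‖x.vel r - y.vel r‖ :=
      Real.iSup_nonneg fun _ => norm_nonneg _
    have hb : BddAbove (Set.range fun r : unitInterval => ‖x.vel r - y.vel r‖) :=
      ⟨dist x.velC y.velC, by rintro _ ⟨r, rfl⟩; exact hle x y r⟩
    rw [hdist, NNReal.coe_one, one_mul, Prod.dist_eq]
    refine max_le ?_ ?_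
    · rw [dist_eq_norm]
      exact le_add_of_nonneg_right h0
    · refine ((ContinuousMap.dist_le h0).2 fun r => ?_).trans
        (le_add_of_nonneg_left (norm_nonneg _))
      rw [dist_eq_norm]
      exact le_ciSup hb r
  exact (hanti.isUniformInducing hlip.uniformContinuous).isInducing.secondCountableTopology

end C1Path

/-- The probability space `(𝒮, μ)` with `𝒮 = supp μ`. -/
def supportMeasure {d : ℕ} (μ : Measure (C1Path d)) : Measure μ.support :=
  μ.comap (Subtype.val : μ.support → C1Path d)

instance {d : ℕ} (μ : Measure (C1Path d)) [IsProbabilityMeasure μ] :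
    IsProbabilityMeasure (supportMeasure μ) where
  measure_univ := by
    rw [supportMeasure, comap_subtype_coe_apply Measure.isClosed_support.measurableSet,
      Set.image_univ, Subtype.range_coe]
    exact (prob_compl_eq_zero_iff Measure.isClosed_support.measurableSet).1
      Measure.measure_compl_support

/-! ### The iterated integrals -/

section Integrals

variable {d : ℕ}

/-- The iterated integral `∫_{s < r₁ < ⋯ < rₙ < t} d⟨z¹, e_{w 1}⟩_{r₁} ⋯ d⟨zⁿ, e_{w n}⟩_{rₙ}` of
the word `w`, the `k`-th letter being integrated against the path `zᵏ`. -/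
def iterInt : (n : ℕ) → (Fin n → Fin d) → (Fin n → C1Path d) → ℝ → ℝ → ℝ
  | 0, _, _, _, _ => 1
  | n + 1, w, z, s, t =>
    ∫ r in s..t, iterInt n (Fin.init w) (Fin.init z) s r *
      (z (Fin.last n)).vel r (w (Fin.last n))

/-- The path driving the letter at position `k`: the tagged path `x` if `k ∈ p₀`, and the path
`y_p` if `k` belongs to the block `p ∈ P`. -/
def driver (W : LionsWord d) (x : C1Path d) (y : W.Block → C1Path d) (k : Fin W.len) : C1Path d :=
  if h : k ∈ W.p0 then x else y ⟨W.P.part k, W.P.part_mem.2 (Finset.mem_compl.2 h)⟩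

/-- The tensor `ℐ^W_{s,t}[x][y_P]`. -/
def wordInt (W : LionsWord d) (s t : ℝ) (x : C1Path d) (y : W.Block → C1Path d) : Tens d W.len :=
  EuclideanSpace.single W.letter (iterInt W.len W.letter (driver W x y) s t)

/-- The relations between the iterated integrals `J W s t x y` with respect to letters, shuffle
products, the operator `ℰ` and grafting. -/
structure IteratedIntegralRelations
    (J : ∀ W : LionsWord d, ℝ → ℝ → C1Path d → (W.Block → C1Path d) → Tens d W.len) : Prop where
  single : ∀ (i : Fin d) (s t : unitInterval) x y, J (LionsWord.single i) s t x y =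
    EuclideanSpace.single (fun _ => i) (x.path t i - x.path s i)
  shuffle : ∀ (W₁ W₂ : LionsWord d) (s t : unitInterval) x (y : (W₁.concat W₂).Block → C1Path d),
    ∑ σ ∈ LionsWord.shuffles W₁.len W₂.len,
      reorder σ (J (W₁.shuffleTerm W₂ σ) s t x fun p => y ((W₁.concat W₂).psi _ p)) =
    tensorAt (Fin.castAdd W₂.len) (Fin.natAdd W₁.len)
      (J W₁ s t x fun p => y (W₁.inl W₂ p)) (J W₂ s t x fun p => y (W₁.inr W₂ p))
  map_E : ∀ (W : LionsWord d) (h : W.p0 ≠ ∅) (s t : unitInterval) x (y : W.E.Block → C1Path d),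
    J W.E s t x y = J W s t (y (W.tagBlock h)) fun p => y (W.oldBlock p)
  graft : ∀ (W : LionsWord d) (i : Fin d) (s t : unitInterval) x
    (y : (W.graft i).Block → C1Path d),
    J (W.graft i) s t x y =
      ∫ r in (s : ℝ)..t, tensorAt (Fin.castAdd 1) (Fin.natAdd W.len)
        (J W s r x fun p => y (W.inl (LionsWord.single i) p))
        (EuclideanSpace.single (fun _ => i) (x.vel r i) : Tens d 1)

/-- The element `ℐ^{γ,α,β}_{s,t}[·, μ] = ∑_{W ∈ 𝒲₀^{γ,α,β}} ℐ^W_{s,t} · W` of the dual module over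
the probability space `(supp μ, μ)`. -/
def pathLift (α β γ : ℝ) (μ : Measure (C1Path d)) (s t : unitInterval) : DualElt d μ.support :=
  fun W ω =>
    open Classical in
    if W ∈ LionsWord.trunc d α β γ then
      wordInt W s t (ω.1 : C1Path d) (fun p => (ω.2 p : C1Path d)) else 0

end Integrals

end

noncomputable section

/-! The tensor `wordInt W` is a scalar iterated integral times one basis tensor `e_w`, and the Lions
structure enters only through `driver`, the assignment of a path to each letter. Restriction,
concatenation and `ℰ` transform this assignment in the evident way (`driver_sub`, `driver_concat`,
`driver_E`), so every algebraic relation reduces to one for iterated integrals of continuous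
functions on the line. Chen's relation (`iterFun_chen`) splits the outermost integral at the
intermediate time and inducts; the shuffle relation (`shuffleSum_eq`) is integration by parts,
according to which word supplies the last letter. All relations hold pointwise, hence almost surely.

For the analysis, a word of length `n` satisfies `|ℐ^W_{s,t}| ≤ ∏ ‖zᵏ‖₁ |t - s|^n ≤ (max ‖zᵏ‖₁)^n |t
- s|^n`. Raised to the power `q'/n`, this is at most `|t - s|^{q'} ∑ ‖zᵏ‖₁^{q'}`
(`norm_wordInt_rpow_le`): one moment of order `q'` controls all words, even when several letters
share a path. This explains the choice `q[W] = q'/|w|`, and `1/q` is then additive in the length,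
which yields the dual pair.

The regularity conditions ask for the exponent `𝒢[W]` where `|w|` is available. As `|t - s| ≤ 1`, it
suffices that `𝒢[W] ≤ |w|` on the truncated set, which follows from `α ∧ β ≤ 1` and the definition
of `γ` (`grade_le_len`). The supremum over uncountably many `s ≠ t` is measurable because it is a
supremum of lower semicontinuous functions (`measurable_condMoment_sup`). -/

/-! ### Iterated integrals of scalar functions -/

/-- The iterated integral `∫_{s < r₁ < ⋯ < rₙ < t} u₁(r₁) ⋯ uₙ(rₙ) dr₁ ⋯ drₙ`. -/
def iterFun : (n : ℕ) → (Fin n → ℝ → ℝ) → ℝ → ℝ → ℝ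
  | 0, _, _, _ => 1
  | n + 1, u, s, t => ∫ r in s..t, iterFun n (Fin.init u) s r * u (Fin.last n) r

theorem iterFun_zero (u : Fin 0 → ℝ → ℝ) (s t : ℝ) : iterFun 0 u s t = 1 := rfl

theorem iterFun_succ {n : ℕ} (u : Fin (n + 1) → ℝ → ℝ) (s t : ℝ) :
    iterFun (n + 1) u s t = ∫ r in s..t, iterFun n (Fin.init u) s r * u (Fin.last n) r := rfl

/-- Serves to compare lengths such as `n + 1 - i` and `(n - i) + 1`, which agree only
propositionally. -/
theorem iterFun_congr {m m' : ℕ} (h : m = m') {u : Fin m → ℝ → ℝ} {u' : Fin m' → ℝ → ℝ}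
    (hu : ∀ k, u k = u' (Fin.cast h k)) (s t : ℝ) : iterFun m u s t = iterFun m' u' s t := by
  subst h
  congr 1
  exact funext hu

theorem iterFun_self {n : ℕ} (u : Fin (n + 1) → ℝ → ℝ) (s : ℝ) : iterFun (n + 1) u s s = 0 := by
  rw [iterFun_succ, intervalIntegral.integral_same]

/-- Iterated integrals depend continuously on the integrands and on the upper end point. -/
theorem continuous_iterFun_uncurry {X : Type*} [TopologicalSpace X] [FirstCountableTopology X]
    {n : ℕ} (u : X → Fin n → ℝ → ℝ) (hu : ∀ k, Continuous fun z : X × ℝ => u z.1 k z.2) (s : ℝ) :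
    Continuous fun z : X × ℝ => iterFun n (u z.1) s z.2 := by
  induction n with
  | zero => exact continuous_const
  | succ n ih =>
    have h := ih (fun x => Fin.init (u x)) fun k => hu k.castSucc
    exact (intervalIntegral.continuous_parametric_primitive_of_continuous (a₀ := s)
      (f := fun x r => iterFun n (Fin.init (u x)) s r * u x (Fin.last n) r)
      (h.mul (hu (Fin.last n))))

theorem continuous_iterFun {n : ℕ} {u : Fin n → ℝ → ℝ} (hu : ∀ k, Continuous (u k)) (s : ℝ) :
    Continuous (iterFun n u s) :=
  (continuous_iterFun_uncurry (X := Unit) (fun _ => u) (fun k => (hu k).comp continuous_snd) s).comp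
    (Continuous.prodMk_right ())

theorem hasDerivAt_iterFun {n : ℕ} {u : Fin (n + 1) → ℝ → ℝ} (hu : ∀ k, Continuous (u k))
    (s t : ℝ) :
    HasDerivAt (iterFun (n + 1) u s) (iterFun n (Fin.init u) s t * u (Fin.last n) t) t := by
  have h : Continuous fun r => iterFun n (Fin.init u) s r * u (Fin.last n) r :=
    (continuous_iterFun (fun k => hu k.castSucc) s).mul (hu _)
  exact intervalIntegral.integral_hasDerivAt_right (h.intervalIntegrable _ _)
    (h.stronglyMeasurableAtFilter _ _) h.continuousAt

/-- Chen's relation. -/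
theorem iterFun_chen {n : ℕ} {u : Fin n → ℝ → ℝ} (hu : ∀ k, Continuous (u k)) (a b c : ℝ) :
    iterFun n u a c = ∑ i : Fin (n + 1),
      iterFun i (u ∘ LionsWord.headEmb i) a b * iterFun (n - i) (u ∘ LionsWord.tailEmb i) b c := by
  induction n generalizing c with
  | zero => simp [iterFun]
  | succ n ih =>
    have hu' : ∀ k, Continuous (Fin.init u k) := fun k => hu k.castSucc
    have hc : Continuous fun r => iterFun n (Fin.init u) a r * u (Fin.last n) r :=
      (continuous_iterFun hu' a).mul (hu _)
    rw [Fin.sum_univ_castSucc]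
    have h1 : iterFun (n + 1 - (Fin.last (n + 1) : Fin (n + 2)))
        (u ∘ LionsWord.tailEmb (Fin.last (n + 1))) b c = 1 :=
      iterFun_congr (m' := 0) (u' := Fin.elim0) (by simp)
        (fun k => (Fin.cast (by simp) k : Fin 0).elim0) b c
    have h2 : iterFun (Fin.last (n + 1) : Fin (n + 2))
        (u ∘ LionsWord.headEmb (Fin.last (n + 1))) a b = iterFun (n + 1) u a b := rfl
    have h3 : ∀ i : Fin (n + 1), iterFun (i.castSucc : Fin (n + 2))
        (u ∘ LionsWord.headEmb i.castSucc) a b =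
          iterFun i (Fin.init u ∘ LionsWord.headEmb i) a b := fun i => rfl
    have h4 : ∀ i : Fin (n + 1), iterFun (n + 1 - (i.castSucc : Fin (n + 2)))
        (u ∘ LionsWord.tailEmb i.castSucc) b c = ∫ r in b..c,
          iterFun (n - i) (Fin.init u ∘ LionsWord.tailEmb i) b r * u (Fin.last n) r := by
      intro i
      have hi := i.2
      refine (iterFun_congr (u := u ∘ LionsWord.tailEmb i.castSucc) (m' := (n - i) + 1)
        (u' := fun k => u ⟨(i : ℕ) + k, by have := k.2; omega⟩)
        (by rw [Fin.val_castSucc]; omega) (fun k => rfl) b c).trans ?_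
      rw [iterFun_succ]
      have h : (⟨(i : ℕ) + (Fin.last (n - (i : ℕ)) : ℕ), by
          rw [Fin.val_last]; omega⟩ : Fin (n + 1)) = Fin.last n := by
        ext; simp only [Fin.val_last]; omega
      simp only [h]
      rfl
    rw [h1, h2, mul_one]
    simp only [h3, h4]
    -- The integral over `a..b` is the term `i = n + 1`. Over `b..c` the induction hypothesis, with
    -- upper end point `r`, is inserted; integrating against the last letter lengthens each tail by
    -- one. Oriented integrals make the order of `a, b, c` irrelevant.
    rw [iterFun_succ u a c, ← intervalIntegral.integral_add_adjacent_intervals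
      (hc.intervalIntegrable a b) (hc.intervalIntegrable b c), ← iterFun_succ u a b, add_comm]
    congr 1
    simp only [ih hu', Finset.sum_mul]
    rw [intervalIntegral.integral_finsetSum]
    · refine Finset.sum_congr rfl fun i _ => ?_
      simp only [mul_assoc]
      rw [intervalIntegral.integral_const_mul]
    · intro i _
      refine Continuous.intervalIntegrable ?_ _ _
      exact (continuous_const.mul (continuous_iterFun (fun k => hu' _) b)).mul (hu _)

/-- Replacing `|r - s|` by `|t - s|` under the integral loses the factor `1/n!`, which is not
needed: only the power of `|t - s|` matters. -/
theorem abs_iterFun_le {n : ℕ} {u : Fin n → ℝ → ℝ} {c : Fin n → ℝ} {s t : ℝ}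
    (hu : ∀ k, ∀ r ∈ uIcc s t, |u k r| ≤ c k) :
    |iterFun n u s t| ≤ (∏ k, c k) * |t - s| ^ n := by
  induction n generalizing t with
  | zero => simp [iterFun]
  | succ n ih =>
    have hsub : ∀ r ∈ uIcc s t, uIcc s r ⊆ uIcc s t := fun r hr =>
      Set.uIcc_subset_uIcc left_mem_uIcc hr
    have hc : ∀ k, 0 ≤ c k := fun k => (abs_nonneg _).trans (hu k s left_mem_uIcc)
    rw [iterFun_succ, ← Real.norm_eq_abs]
    have h := intervalIntegral.norm_integral_le_of_norm_le_const
      (C := (∏ k, c k) * |t - s| ^ n) (a := s) (b := t)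
      (f := fun r => iterFun n (Fin.init u) s r * u (Fin.last n) r) (fun r hr => by
        have hr' : r ∈ uIcc s t := Set.uIoc_subset_uIcc hr
        have h1 := ih (u := Fin.init u) (c := Fin.init c) (t := r)
          fun k r' hr'' => hu k.castSucc r' (hsub r hr' hr'')
        have h2 : |r - s| ≤ |t - s| := by
          exact Set.abs_sub_left_of_mem_uIcc hr'
        have h0 : 0 ≤ ∏ k, Fin.init c k := Finset.prod_nonneg fun k _ => hc k.castSucc
        rw [norm_mul, Real.norm_eq_abs, Real.norm_eq_abs, Fin.prod_univ_castSucc]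
        calc |iterFun n (Fin.init u) s r| * |u (Fin.last n) r|
            ≤ ((∏ k, Fin.init c k) * |t - s| ^ n) * c (Fin.last n) := by
              refine mul_le_mul (h1.trans ?_) (hu _ r hr') (abs_nonneg _) (by positivity)
              gcongr
          _ = _ := by simp only [Fin.init]; ring)
    rw [pow_succ, ← mul_assoc]
    exact h

/-! ### The shuffle relation -/

/-- Shuffles of `m` and `n` ordered letters into `N` places. -/
def sumShuffles (N m n : ℕ) : Finset (Fin N ≃ Fin m ⊕ Fin n) :=
  open Classical in Finset.univ.filter fun e =>
    StrictMono (fun a => e.symm (Sum.inl a)) ∧ StrictMono (fun b => e.symm (Sum.inr b))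

theorem mem_sumShuffles {N m n : ℕ} {e : Fin N ≃ Fin m ⊕ Fin n} :
    e ∈ sumShuffles N m n ↔
      StrictMono (fun a => e.symm (Sum.inl a)) ∧ StrictMono (fun b => e.symm (Sum.inr b)) := by
  simp [sumShuffles]

/-- Splitting off the last element of the second summand. -/
def sumFinSuccEquiv (m n : ℕ) : Option (Fin m ⊕ Fin n) ≃ Fin m ⊕ Fin (n + 1) where
  toFun z := z.elim (Sum.inr (Fin.last n)) (Sum.map id Fin.castSucc)
  invFun := Sum.elim (fun a => some (Sum.inl a))
    (fun b => Fin.lastCases (motive := fun _ => Option (Fin m ⊕ Fin n)) none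
      (fun b => some (Sum.inr b)) b)
  left_inv z := by rcases z with _ | z | z <;> simp
  right_inv z := by
    rcases z with a | b
    · simp
    · induction b using Fin.lastCases <;> simp

/-- Extend a bijection by letting the last places correspond to each other. -/
def extendLast {N m n : ℕ} (e : Fin N ≃ Fin m ⊕ Fin n) : Fin (N + 1) ≃ Fin m ⊕ Fin (n + 1) :=
  finSuccEquivLast.trans (e.optionCongr.trans (sumFinSuccEquiv m n))

section extendLast

variable {N m n : ℕ} (e : Fin N ≃ Fin m ⊕ Fin n)

theorem extendLast_castSucc (k : Fin N) :
    extendLast e k.castSucc = Sum.map id Fin.castSucc (e k) := by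
  simp [extendLast, sumFinSuccEquiv]

theorem extendLast_last : extendLast e (Fin.last N) = Sum.inr (Fin.last n) := by
  simp [extendLast, sumFinSuccEquiv]

theorem extendLast_symm_inl (a : Fin m) :
    (extendLast e).symm (Sum.inl a) = (e.symm (Sum.inl a)).castSucc := by
  rw [Equiv.symm_apply_eq, extendLast_castSucc]
  simp

theorem extendLast_symm_inr (b : Fin n) :
    (extendLast e).symm (Sum.inr b.castSucc) = (e.symm (Sum.inr b)).castSucc := by
  rw [Equiv.symm_apply_eq, extendLast_castSucc]
  simp

theorem extendLast_symm_last : (extendLast e).symm (Sum.inr (Fin.last n)) = Fin.last N := by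
  rw [Equiv.symm_apply_eq, extendLast_last]

theorem extendLast_injective :
    Function.Injective (extendLast : (Fin N ≃ Fin m ⊕ Fin n) → _) := by
  intro e e' h
  ext k : 1
  have h1 := DFunLike.congr_fun h k.castSucc
  rw [extendLast_castSucc, extendLast_castSucc] at h1
  exact Function.Injective.sumMap Function.injective_id (Fin.castSucc_injective n) h1

/-- Through `Option` both last elements become `none`, and a bijection fixing `none` restricts to
the remaining elements. -/
theorem exists_extendLast {e : Fin (N + 1) ≃ Fin m ⊕ Fin (n + 1)}
    (he : e (Fin.last N) = Sum.inr (Fin.last n)) : ∃ e', extendLast e' = e := by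
  let f : Option (Fin N) ≃ Option (Fin m ⊕ Fin n) :=
    finSuccEquivLast.symm.trans (e.trans (sumFinSuccEquiv m n).symm)
  have hf : f none = none := by
    simp [f, he, Equiv.symm_apply_eq]
    rfl
  refine ⟨Equiv.removeNone f, ?_⟩
  have h : (Equiv.removeNone f).optionCongr = f := by
    ext1 k
    rcases k with _ | k
    · simp [hf]
    · rw [Equiv.optionCongr_apply, Option.map_some, Equiv.removeNone_some]
      by_contra hk
      rw [not_exists] at hk
      have : f (some k) = none := Option.eq_none_iff_forall_ne_some.2 fun z hz => hk z hz
      rw [← hf] at this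
      exact absurd (f.injective this) (by simp)
  ext1 k
  simp [extendLast, h, f]

end extendLast

theorem extendLast_mem {N m n : ℕ} {e : Fin N ≃ Fin m ⊕ Fin n} :
    extendLast e ∈ sumShuffles (N + 1) m (n + 1) ↔ e ∈ sumShuffles N m n := by
  rw [mem_sumShuffles, mem_sumShuffles]
  simp only [extendLast_symm_inl]
  refine and_congr ⟨fun h a b hab => by simpa using h hab, fun h a b hab => by simpa using h hab⟩
    ⟨fun h a b hab => ?_, fun h a b hab => ?_⟩
  · have := h (Fin.castSucc_lt_castSucc_iff.2 hab)
    simpa [extendLast_symm_inr] using this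
  · dsimp only
    induction b using Fin.lastCases with
    | last =>
      rw [extendLast_symm_last]
      induction a using Fin.lastCases with
      | last => exact absurd hab (lt_irrefl _)
      | cast a => rw [extendLast_symm_inr]; exact Fin.castSucc_lt_last _
    | cast b =>
      induction a using Fin.lastCases with
      | last => exact absurd hab (not_lt.2 (Fin.le_last _))
      | cast a =>
        rw [extendLast_symm_inr, extendLast_symm_inr]
        exact Fin.castSucc_lt_castSucc_iff.2 (h (Fin.castSucc_lt_castSucc_iff.1 hab))

/-- The sum of the iterated integrals over all shuffles of `u` and `v`. -/
def shuffleSum (N : ℕ) {m n : ℕ} (u : Fin m → ℝ → ℝ) (v : Fin n → ℝ → ℝ) (s t : ℝ) : ℝ :=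
  ∑ e ∈ sumShuffles N m n, iterFun N (Sum.elim u v ∘ e) s t

-- Deleting the last letter leaves a shuffle of `u` and `Fin.init v`, and the deleted letter is the
-- variable of the outermost integral.
open Classical in
theorem sum_filter_isRight {N m n : ℕ} {u : Fin m → ℝ → ℝ} {v : Fin (n + 1) → ℝ → ℝ}
    (hu : ∀ k, Continuous (u k)) (hv : ∀ k, Continuous (v k)) (s t : ℝ) :
    ∑ e ∈ sumShuffles (N + 1) m (n + 1) with (e (Fin.last N)).isRight,
      iterFun (N + 1) (Sum.elim u v ∘ e) s t =
    ∫ r in s..t, shuffleSum N u (Fin.init v) s r * v (Fin.last n) r := by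
  have himg : (sumShuffles (N + 1) m (n + 1)).filter (fun e => (e (Fin.last N)).isRight) =
      (sumShuffles N m n).map ⟨extendLast, extendLast_injective⟩ := by
    ext e
    simp only [Finset.mem_filter, Finset.mem_map, Function.Embedding.coeFn_mk]
    constructor
    · rintro ⟨he, hr⟩
      obtain ⟨b, hb⟩ := Sum.isRight_iff.1 hr
      -- Order preservation would force the last letter of `v` to stand strictly after the last
      -- place if `b` were an earlier letter.
      have hlast : b = Fin.last n := by
        by_contra hne
        have h1 := (mem_sumShuffles.1 he).2 (Fin.lt_last_iff_ne_last.2 hne)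
        dsimp only at h1
        rw [← hb, Equiv.symm_apply_apply] at h1
        exact absurd h1 (not_lt.2 (Fin.le_last _))
      obtain ⟨e', rfl⟩ := exists_extendLast (hb.trans (by rw [hlast]))
      exact ⟨e', extendLast_mem.1 he, rfl⟩
    · rintro ⟨e', he', rfl⟩
      exact ⟨extendLast_mem.2 he', by rw [extendLast_last]; rfl⟩
  have hc : ∀ z, Continuous (Sum.elim u v z) := by rintro (a | b) <;> simp [hu, hv]
  rw [himg, Finset.sum_map]
  simp only [shuffleSum, Finset.sum_mul]
  rw [intervalIntegral.integral_finsetSum]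
  · refine Finset.sum_congr rfl fun e _ => ?_
    have h1 : Fin.init (Sum.elim u v ∘ extendLast e) = Sum.elim u (Fin.init v) ∘ e := by
      funext k
      simp only [Fin.init, Function.comp, extendLast_castSucc]
      rcases e k with a | b <;> rfl
    have h2 : (Sum.elim u v ∘ extendLast e) (Fin.last N) = v (Fin.last n) := by
      simp [extendLast_last]
    simp only [Function.Embedding.coeFn_mk]
    rw [iterFun_succ, h1, h2]
  · intro e _
    refine Continuous.intervalIntegrable ((continuous_iterFun (fun k => ?_) s).mul (hv _)) _ _
    dsimp only [Function.comp]
    rcases e k with a | b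
    · exact hu a
    · exact hv b.castSucc

theorem sumShuffles_swap (N m n : ℕ) :
    (sumShuffles N m n).map (Equiv.toEmbedding ((Equiv.refl _).equivCongr (Equiv.sumComm _ _))) =
      sumShuffles N n m := by
  ext e
  rw [Finset.mem_map_equiv, mem_sumShuffles, mem_sumShuffles, and_comm]
  rfl

-- The mirror image of `sum_filter_isRight`, obtained by exchanging the two summands.
open Classical in
theorem sum_filter_isLeft {N m n : ℕ} {u : Fin (m + 1) → ℝ → ℝ} {v : Fin n → ℝ → ℝ}
    (hu : ∀ k, Continuous (u k)) (hv : ∀ k, Continuous (v k)) (s t : ℝ) :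
    ∑ e ∈ sumShuffles (N + 1) (m + 1) n with ¬ (e (Fin.last N)).isRight,
      iterFun (N + 1) (Sum.elim u v ∘ e) s t =
    ∫ r in s..t, shuffleSum N (Fin.init u) v s r * u (Fin.last m) r := by
  have hcomm : ∀ (N' m' n' : ℕ) (u' : Fin m' → ℝ → ℝ) (v' : Fin n' → ℝ → ℝ) (r : ℝ),
      ∀ e : Fin N' ≃ Fin m' ⊕ Fin n', iterFun N' (Sum.elim v' u' ∘
        ((Equiv.refl _).equivCongr (Equiv.sumComm _ _) e)) s r =
        iterFun N' (Sum.elim u' v' ∘ e) s r := by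
    intro N' m' n' u' v' r e
    congr 1
    funext k
    simp only [Function.comp, Equiv.equivCongr_apply_apply, Equiv.refl_symm, Equiv.refl_apply,
      Equiv.sumComm_apply]
    rcases e k with a | b <;> rfl
  have h := sum_filter_isRight (N := N) hv hu s t
  rw [← sumShuffles_swap, Finset.filter_map, Finset.sum_map] at h
  have h2 : ∀ r, shuffleSum N v (Fin.init u) s r = shuffleSum N (Fin.init u) v s r := by
    intro r
    rw [shuffleSum, ← sumShuffles_swap, Finset.sum_map]
    exact Finset.sum_congr rfl fun e _ => hcomm _ _ _ _ _ r e
  simp only [h2] at h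
  rw [← h]
  refine Finset.sum_congr ?_ fun e _ => (hcomm _ _ _ _ _ t e).symm
  refine Finset.filter_congr fun e _ => ?_
  simp

/-- The product rule for the right-hand side: its derivative in `t` has two terms, matching the
shuffles that end in a letter of `v` and of `u`. Keeping `N` as a variable avoids casts between `m +
1 + n` and `m + (n + 1)` in the induction. -/
theorem shuffleSum_eq {N m n : ℕ} (hN : N = m + n) {u : Fin m → ℝ → ℝ} {v : Fin n → ℝ → ℝ}
    (hu : ∀ k, Continuous (u k)) (hv : ∀ k, Continuous (v k)) (s t : ℝ) :
    shuffleSum N u v s t = iterFun m u s t * iterFun n v s t := by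
  classical
  induction N generalizing m n t with
  | zero =>
    obtain rfl : m = 0 := by omega
    obtain rfl : n = 0 := by omega
    have h : sumShuffles 0 0 0 = {Equiv.equivOfIsEmpty _ _} := by
      ext e
      simp only [mem_sumShuffles, Finset.mem_singleton]
      exact ⟨fun _ => Subsingleton.elim _ _, fun _ => ⟨fun a => a.elim0, fun a => a.elim0⟩⟩
    rw [shuffleSum, h, Finset.sum_singleton]
    simp [iterFun_zero]
  | succ N ih =>
    rw [shuffleSum, ← Finset.sum_filter_add_sum_filter_not _
      (fun e : Fin (N + 1) ≃ Fin m ⊕ Fin n => (e (Fin.last N)).isRight)]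
    rcases m with _ | m <;> rcases n with _ | n
    · omega
    · have h0 : (sumShuffles (N + 1) 0 (n + 1)).filter
          (fun e => ¬ (e (Fin.last N)).isRight) = ∅ :=
        Finset.filter_eq_empty_iff.2 fun e _ => by
          rcases e (Fin.last N) with a | b
          · exact a.elim0
          · simp
      rw [h0, Finset.sum_empty, add_zero, sum_filter_isRight hu hv, iterFun_zero, one_mul,
        iterFun_succ]
      congr 1
      funext r
      rw [ih (v := Fin.init v) (by omega) hu (fun k => hv k.castSucc), iterFun_zero, one_mul]
    · have h0 : (sumShuffles (N + 1) (m + 1) 0).filter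
          (fun e => (e (Fin.last N)).isRight) = ∅ :=
        Finset.filter_eq_empty_iff.2 fun e _ => by
          rcases e (Fin.last N) with a | b
          · simp
          · exact b.elim0
      rw [h0, Finset.sum_empty, zero_add, sum_filter_isLeft hu hv, iterFun_zero, mul_one,
        iterFun_succ]
      congr 1
      funext r
      rw [ih (u := Fin.init u) (by omega) (fun k => hu k.castSucc) hv, iterFun_zero, mul_one]
    · rw [sum_filter_isRight hu hv, sum_filter_isLeft hu hv]
      have hu' : ∀ k, Continuous (Fin.init u k) := fun k => hu k.castSucc
      have hv' : ∀ k, Continuous (Fin.init v k) := fun k => hv k.castSucc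
      have cu := continuous_iterFun hu s
      have cv := continuous_iterFun hv s
      have cu' := continuous_iterFun hu' s
      have cv' := continuous_iterFun hv' s
      have hl := hu (Fin.last m)
      have hl' := hv (Fin.last n)
      have key := intervalIntegral.integral_deriv_mul_eq_sub (a := s) (b := t)
        (fun r _ => hasDerivAt_iterFun hu s r) (fun r _ => hasDerivAt_iterFun hv s r)
        ((cu'.mul hl).intervalIntegrable _ _) ((cv'.mul hl').intervalIntegrable _ _)
      rw [iterFun_self, zero_mul, sub_zero] at key
      rw [← key]
      simp only [ih (show N = m + 1 + n by omega) hu hv', ih (show N = m + (n + 1) by omega) hu' hv]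
      rw [← intervalIntegral.integral_add]
      · congr 1
        funext r
        ring
      · exact ((cu.mul cv').mul hl').intervalIntegrable _ _
      · exact ((cu'.mul cv).mul hl).intervalIntegrable _ _

/-- The shuffle relation for iterated integrals. -/
theorem sum_shuffles_iterFun {m n : ℕ} {u : Fin m → ℝ → ℝ} {v : Fin n → ℝ → ℝ}
    (hu : ∀ k, Continuous (u k)) (hv : ∀ k, Continuous (v k)) (s t : ℝ) :
    ∑ σ ∈ LionsWord.shuffles m n, iterFun (m + n) (Fin.append u v ∘ σ) s t =
      iterFun m u s t * iterFun n v s t := by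
  rw [← shuffleSum_eq rfl hu hv, shuffleSum]
  refine Finset.sum_equiv ((Equiv.refl _).equivCongr finSumFinEquiv.symm) (fun σ => ?_)
    fun σ _ => ?_
  · rw [mem_sumShuffles]
    simp only [LionsWord.shuffles, Finset.mem_filter, Finset.mem_univ, true_and]
    rfl
  · congr 1
    funext k
    simp only [Function.comp, Equiv.equivCongr_apply_apply, Equiv.refl_symm, Equiv.refl_apply]
    generalize σ k = j
    induction j using Fin.addCases <;> simp

/-! ### Continuously differentiable paths and their iterated integrals -/

namespace C1Path

variable {d : ℕ}

theorem norm_vel_le (x : C1Path d) (r : unitInterval) : ‖x.vel r‖ ≤ ‖x‖ :=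
  (le_ciSup x.bddAbove_vel r).trans (le_add_of_nonneg_left (norm_nonneg _))

/-- Differentiation is 1-Lipschitz from `C¹` to the uniform norm; continuity of iterated integrals
in their driving paths rests on this. -/
theorem continuous_velC : Continuous (velC : C1Path d → _) := by
  refine (LipschitzWith.of_dist_le_mul (K := 1) fun x y => ?_).continuous
  rw [NNReal.coe_one, one_mul]
  refine (ContinuousMap.dist_le dist_nonneg).2 fun r => ?_
  have h : (x - y).vel r = x.vel r - y.vel r := by
    rw [sub_eq_add_neg, vel_add, vel_neg, sub_eq_add_neg]
  rw [dist_eq_norm, dist_eq_norm]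
  exact h ▸ norm_vel_le (x - y) r

/-- The `i`-th coordinate of the derivative, extended to the real line by constants. -/
def velCoord (x : C1Path d) (i : Fin d) (r : ℝ) : ℝ := x.vel (projIcc 0 1 zero_le_one r) i

theorem velCoord_of_mem (x : C1Path d) (i : Fin d) {r : ℝ} (hr : r ∈ Icc (0 : ℝ) 1) :
    x.velCoord i r = x.vel r i := by
  rw [velCoord, projIcc_of_mem zero_le_one hr]

theorem continuous_velCoord_uncurry (i : Fin d) :
    Continuous fun z : C1Path d × ℝ => z.1.velCoord i z.2 := by
  have h : Continuous fun z : C1Path d × ℝ => z.1.velC (projIcc 0 1 zero_le_one z.2) :=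
    (continuous_velC.comp continuous_fst).eval (continuous_projIcc.comp continuous_snd)
  exact (EuclideanSpace.proj (𝕜 := ℝ) i).continuous.comp h

theorem continuous_velCoord (x : C1Path d) (i : Fin d) : Continuous (x.velCoord i) :=
  (continuous_velCoord_uncurry i).comp (Continuous.prodMk_right x)

theorem abs_velCoord_le (x : C1Path d) (i : Fin d) (r : ℝ) : |x.velCoord i r| ≤ ‖x‖ := by
  rw [← Real.norm_eq_abs]
  exact (PiLp.norm_apply_le _ i).trans (norm_vel_le x _)

theorem integral_vel (x : C1Path d) (i : Fin d) (s t : unitInterval) :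
    ∫ r in (s : ℝ)..t, x.vel r i = x.path t i - x.path s i := by
  have hsub : uIcc (s : ℝ) t ⊆ Icc 0 1 := Set.uIcc_subset_Icc s.2 t.2
  refine intervalIntegral.integral_eq_sub_of_hasDeriv_right
    (f := fun r => x.path r i) (f' := fun r => x.vel r i) ?_ ?_ ?_
  · exact (EuclideanSpace.proj i : EuclideanSpace ℝ (Fin d) →L[ℝ] ℝ).continuous.comp_continuousOn
      (x.contDiffOn.continuousOn.mono hsub)
  · intro r hr
    have hr1 : Ioo (min (s : ℝ) t) (max (s : ℝ) t) ⊆ Icc 0 1 :=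
      fun r hr => hsub ⟨hr.1.le, hr.2.le⟩
    -- At interior points the derivative within `[0,1]` is a genuine derivative.
    have hn : Icc (0 : ℝ) 1 ∈ nhds r :=
      Filter.mem_of_superset (isOpen_Ioo.mem_nhds hr) hr1
    have h := ((x.contDiffOn.differentiableOn one_ne_zero) r (hr1 hr)).hasDerivWithinAt.hasDerivAt hn
    exact ((EuclideanSpace.proj i : EuclideanSpace ℝ (Fin d) →L[ℝ] ℝ).hasFDerivAt.comp_hasDerivAt
      r h).hasDerivWithinAt
  · exact ((EuclideanSpace.proj i : EuclideanSpace ℝ (Fin d) →L[ℝ] ℝ).continuous.comp_continuousOn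
      (x.continuousOn_vel.mono hsub)).intervalIntegrable

end C1Path

variable {d : ℕ}

/-- Continuity of `vel` is available only on `[0,1]`, while the scalar theory asks for continuity on
the whole line. Passing to the constant extension is harmless, since all integration variables stay
between `s` and `t`. -/
theorem iterInt_eq_iterFun {n : ℕ} (w : Fin n → Fin d) (z : Fin n → C1Path d) {s t : ℝ}
    (hs : s ∈ Icc (0 : ℝ) 1) (ht : t ∈ Icc (0 : ℝ) 1) :
    iterInt n w z s t = iterFun n (fun k => (z k).velCoord (w k)) s t := by
  induction n generalizing t with
  | zero => rfl
  | succ n ih =>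
    refine intervalIntegral.integral_congr fun r hr => ?_
    have hr' : r ∈ Icc (0 : ℝ) 1 := Set.uIcc_subset_Icc hs ht hr
    dsimp only
    rw [ih _ _ hr', C1Path.velCoord_of_mem _ _ hr']
    rfl

theorem continuous_iterInt {n : ℕ} (w : Fin n → Fin d) (s t : unitInterval) :
    Continuous fun z : Fin n → C1Path d => iterInt n w z s t := by
  have h : ∀ z : Fin n → C1Path d, iterInt n w z s t =
      iterFun n (fun k => (z k).velCoord (w k)) s t := fun z => iterInt_eq_iterFun w z s.2 t.2
  simp only [h]
  exact (continuous_iterFun_uncurry (fun (z : Fin n → C1Path d) k => (z k).velCoord (w k))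
    (fun k => (C1Path.continuous_velCoord_uncurry (w k)).comp
      (g := fun z : C1Path d × ℝ => z.1.velCoord (w k) z.2)
      (f := fun z : (Fin n → C1Path d) × ℝ => (z.1 k, z.2))
      (((continuous_apply k).comp continuous_fst).prodMk continuous_snd)) s).comp
    (Continuous.prodMk_left (t : ℝ))

theorem abs_iterInt_le {n : ℕ} (w : Fin n → Fin d) (z : Fin n → C1Path d) (s t : unitInterval) :
    |iterInt n w z s t| ≤ (∏ k, ‖z k‖) * |(t : ℝ) - s| ^ n := by
  rw [iterInt_eq_iterFun w z s.2 t.2]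
  exact abs_iterFun_le fun k r _ => (z k).abs_velCoord_le (w k) r

theorem iterInt_chen {n : ℕ} (w : Fin n → Fin d) (z : Fin n → C1Path d) (s t u : unitInterval) :
    iterInt n w z s u = ∑ i : Fin (n + 1),
      iterInt i (w ∘ LionsWord.headEmb i) (z ∘ LionsWord.headEmb i) s t *
        iterInt (n - i) (w ∘ LionsWord.tailEmb i) (z ∘ LionsWord.tailEmb i) t u := by
  rw [iterInt_eq_iterFun w z s.2 u.2, iterFun_chen (fun k => (z k).continuous_velCoord (w k)) s t u]
  refine Finset.sum_congr rfl fun i _ => ?_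
  rw [iterInt_eq_iterFun _ _ s.2 t.2, iterInt_eq_iterFun _ _ t.2 u.2]
  rfl

theorem sum_shuffles_iterInt {m n : ℕ} (w₁ : Fin m → Fin d) (w₂ : Fin n → Fin d)
    (z₁ : Fin m → C1Path d) (z₂ : Fin n → C1Path d) (s t : unitInterval) :
    ∑ σ ∈ LionsWord.shuffles m n,
      iterInt (m + n) (Fin.append w₁ w₂ ∘ σ) (Fin.append z₁ z₂ ∘ σ) s t =
    iterInt m w₁ z₁ s t * iterInt n w₂ z₂ s t := by
  rw [iterInt_eq_iterFun w₁ z₁ s.2 t.2, iterInt_eq_iterFun w₂ z₂ s.2 t.2, ← sum_shuffles_iterFun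
    (fun k => (z₁ k).continuous_velCoord (w₁ k)) (fun k => (z₂ k).continuous_velCoord (w₂ k))]
  refine Finset.sum_congr rfl fun σ _ => ?_
  rw [iterInt_eq_iterFun _ _ s.2 t.2]
  congr 1
  funext k
  simp only [Function.comp]
  generalize σ k = j
  induction j using Fin.addCases <;> simp

/-! ### Simple tensors -/

/-- Since the two families of positions cover everything, a multi-index is determined by its two
restrictions. -/
theorem tensorAt_single {a b n : ℕ} {e₁ : Fin a → Fin n} {e₂ : Fin b → Fin n}
    (he : ∀ k, (∃ a, e₁ a = k) ∨ ∃ b, e₂ b = k) (l : Fin n → Fin d) (c c' : ℝ) :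
    tensorAt e₁ e₂ (EuclideanSpace.single (l ∘ e₁) c) (EuclideanSpace.single (l ∘ e₂) c') =
      (EuclideanSpace.single l (c * c') : Tens d n) := by
  ext j
  have h : j = l ↔ j ∘ e₁ = l ∘ e₁ ∧ j ∘ e₂ = l ∘ e₂ := by
    refine ⟨fun h => by simp [h], fun h => funext fun k => ?_⟩
    rcases he k with ⟨a, rfl⟩ | ⟨b, rfl⟩
    · exact congrFun h.1 a
    · exact congrFun h.2 b
  simp only [tensorAt, PiLp.single_apply]
  by_cases h1 : j ∘ e₁ = l ∘ e₁ <;> by_cases h2 : j ∘ e₂ = l ∘ e₂ <;> simp [h, h1, h2]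

theorem reorder_single {n : ℕ} (σ : Equiv.Perm (Fin n)) (l : Fin n → Fin d) (c : ℝ) :
    reorder σ (EuclideanSpace.single (l ∘ σ) c) = (EuclideanSpace.single l c : Tens d n) := by
  ext j
  simp [reorder, PiLp.single_apply, σ.surjective.injective_comp_right.eq_iff]

/-- Isolates the scalar, so that sums and integrals of multiples of one basis tensor become scalar
ones. -/
theorem euclideanSpace_single_eq_smul {ι : Type*} [Fintype ι] [DecidableEq ι] (i : ι) (c : ℝ) :
    (EuclideanSpace.single i c : EuclideanSpace ℝ ι) = c • EuclideanSpace.single i 1 := by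
  ext j
  by_cases h : j = i <;> simp [h]

/-! ### The paths driving a word -/

section driver

variable {W : LionsWord d} {x : C1Path d} {y : W.Block → C1Path d}

theorem driver_of_mem_p0 {k : Fin W.len} (h : k ∈ W.p0) : driver W x y k = x := dif_pos h

theorem driver_of_mem_block {k : Fin W.len} {p : W.Block} (h : k ∈ p.1) :
    driver W x y k = y p := by
  have h0 : k ∉ W.p0 := Finset.mem_compl.1 (W.P.le p.2 h)
  rw [driver, dif_neg h0]
  congr 1
  exact Subtype.ext (W.P.part_eq_of_mem p.2 h)

theorem exists_block {k : Fin W.len} (h : k ∉ W.p0) : ∃ p : W.Block, k ∈ p.1 := by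
  obtain ⟨p, hp, hk⟩ := W.P.exists_mem (Finset.mem_compl.2 h)
  exact ⟨⟨p, hp⟩, hk⟩

theorem mem_sub_p0 (W : LionsWord d) {m : ℕ} (e : Fin m ↪ Fin W.len) (k : Fin m) :
    (show Fin (W.sub e).len from k) ∈ (W.sub e).p0 ↔ e k ∈ W.p0 :=
  show k ∈ Finset.univ.filter (fun k : Fin m => e k ∈ W.p0) ↔ _ from by simp

/-- A trace carries the variable of the block it comes from, so each letter keeps its path. This one
fact serves both deconcatenations and shuffles. -/
theorem driver_sub {m : ℕ} (e : Fin m ↪ Fin W.len) :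
    driver (W.sub e) x (fun p => y (W.psi e p)) = driver W x y ∘ e := by
  funext (k : Fin m)
  by_cases h : e k ∈ W.p0
  · exact (driver_of_mem_p0 (W := W.sub e) ((mem_sub_p0 W e k).2 h)).trans
      (driver_of_mem_p0 h).symm
  · have h' := mt (mem_sub_p0 W e k).1 h
    obtain ⟨q, hq⟩ := exists_block (W := W.sub e) h'
    rw [driver_of_mem_block (W := W.sub e) hq]
    have h2 : e k ∈ (W.psi e q).1 := by
      have hq' : k ∈ Finset.univ.filter (fun k : Fin m => e k ∈ (W.psi e q).1) := by
        rw [W.psi_spec e q]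
        exact hq
      exact (Finset.mem_filter.1 hq').2
    exact (driver_of_mem_block h2).symm

theorem driver_concat {W₁ W₂ : LionsWord d} {y : (W₁.concat W₂).Block → C1Path d} :
    driver (W₁.concat W₂) x y = Fin.append (driver W₁ x fun p => y (W₁.inl W₂ p))
      (driver W₂ x fun p => y (W₁.inr W₂ p)) := by
  funext (k : Fin (W₁.len + W₂.len))
  induction k using Fin.addCases with
  | left a =>
    rw [Fin.append_left]
    by_cases h : a ∈ W₁.p0
    · rw [driver_of_mem_p0 h]
      exact driver_of_mem_p0 (W := W₁.concat W₂)
        (Finset.mem_union_left _ ((LionsWord.castAdd_mem a _).2 h))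
    · obtain ⟨p, hp⟩ := exists_block h
      rw [driver_of_mem_block hp]
      exact driver_of_mem_block (W := W₁.concat W₂) (p := W₁.inl W₂ p)
        ((LionsWord.castAdd_mem a _).2 hp)
  | right a =>
    rw [Fin.append_right]
    by_cases h : a ∈ W₂.p0
    · rw [driver_of_mem_p0 h]
      exact driver_of_mem_p0 (W := W₁.concat W₂)
        (Finset.mem_union_right _ ((LionsWord.natAdd_mem a _).2 h))
    · obtain ⟨p, hp⟩ := exists_block h
      rw [driver_of_mem_block hp]
      exact driver_of_mem_block (W := W₁.concat W₂) (p := W₁.inr W₂ p)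
        ((LionsWord.natAdd_mem a _).2 hp)

theorem driver_E (h : W.p0 ≠ ∅) {y : W.E.Block → C1Path d} :
    driver W.E x y = driver W (y (W.tagBlock h)) fun p => y (W.oldBlock p) := by
  funext (k : Fin W.len)
  by_cases hk : k ∈ W.p0
  · rw [driver_of_mem_p0 hk]
    exact driver_of_mem_block (W := W.E) (p := W.tagBlock h) hk
  · obtain ⟨p, hp⟩ := exists_block hk
    rw [driver_of_mem_block hp]
    exact driver_of_mem_block (W := W.E) (p := W.oldBlock p) hp

theorem continuous_driver (W : LionsWord d) :
    Continuous fun z : C1Path d × (W.Block → C1Path d) => driver W z.1 z.2 := by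
  refine continuous_pi fun k => ?_
  by_cases hk : k ∈ W.p0
  · simp only [driver_of_mem_p0 hk]
    exact continuous_fst
  · obtain ⟨p, hp⟩ := exists_block hk
    simp only [driver_of_mem_block hp]
    exact (continuous_apply p).comp continuous_snd

end driver

/-! ### The tensors of iterated integrals -/

theorem wordInt_sub (W : LionsWord d) {m : ℕ} (e : Fin m ↪ Fin W.len) (s t : ℝ) (x : C1Path d)
    (y : W.Block → C1Path d) :
    wordInt (W.sub e) s t x (fun p => y (W.psi e p)) =
      (EuclideanSpace.single (W.letter ∘ e)
        (iterInt m (W.letter ∘ e) (driver W x y ∘ e) s t) : Tens d m) := by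
  rw [wordInt, driver_sub]
  rfl

theorem wordInt_shuffle (W₁ W₂ : LionsWord d) (s t : unitInterval) (x : C1Path d)
    (y : (W₁.concat W₂).Block → C1Path d) :
    ∑ σ ∈ LionsWord.shuffles W₁.len W₂.len,
      reorder σ (wordInt (W₁.shuffleTerm W₂ σ) s t x fun p => y ((W₁.concat W₂).psi _ p)) =
    tensorAt (Fin.castAdd W₂.len) (Fin.natAdd W₁.len)
      (wordInt W₁ s t x fun p => y (W₁.inl W₂ p)) (wordInt W₂ s t x fun p => y (W₁.inr W₂ p)) := by
  have hl : (Fin.append W₁.letter W₂.letter) ∘ Fin.castAdd W₂.len = W₁.letter := by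
    funext k; simp
  have hr : (Fin.append W₁.letter W₂.letter) ∘ Fin.natAdd W₁.len = W₂.letter := by
    funext k; simp
  have hrhs := tensorAt_single (d := d) (e₁ := Fin.castAdd W₂.len) (e₂ := Fin.natAdd W₁.len)
    (fun k => Fin.addCases (fun a => Or.inl ⟨a, rfl⟩) (fun b => Or.inr ⟨b, rfl⟩) k)
    (Fin.append W₁.letter W₂.letter)
    (iterInt W₁.len W₁.letter (driver W₁ x fun p => y (W₁.inl W₂ p)) s t)
    (iterInt W₂.len W₂.letter (driver W₂ x fun p => y (W₁.inr W₂ p)) s t)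
  rw [hl, hr] at hrhs
  refine Eq.trans ?_ hrhs.symm
  rw [← sum_shuffles_iterInt, euclideanSpace_single_eq_smul, Finset.sum_smul]
  refine Finset.sum_congr rfl fun σ _ => ?_
  rw [← euclideanSpace_single_eq_smul]
  have h := wordInt_sub (W₁.concat W₂) (m := W₁.len + W₂.len) σ.toEmbedding s t x y
  rw [driver_concat] at h
  refine (congrArg (reorder σ) h).trans ?_
  exact reorder_single σ (Fin.append W₁.letter W₂.letter) _

theorem wordInt_E (W : LionsWord d) (h : W.p0 ≠ ∅) (s t : ℝ) (x : C1Path d)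
    (y : W.E.Block → C1Path d) :
    wordInt W.E s t x y = wordInt W s t (y (W.tagBlock h)) fun p => y (W.oldBlock p) := by
  rw [wordInt, driver_E h]
  rfl

/-- Head and tail occupy complementary positions and use restrictions of the same path assignment,
so every summand is a multiple of `e_w` and the scalar Chen relation applies. -/
theorem wordInt_chen (W : LionsWord d) (s t u : unitInterval) (x : C1Path d)
    (y : W.Block → C1Path d) :
    ∑ i : Fin (W.len + 1), tensorAt (LionsWord.headEmb i) (LionsWord.tailEmb i)
      (wordInt (W.head i) s t x fun p => y (W.psi (LionsWord.headEmb i) p))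
      (wordInt (W.tail i) t u x fun p => y (W.psi (LionsWord.tailEmb i) p)) =
    wordInt W s u x y := by
  rw [wordInt, iterInt_chen _ _ s t u, euclideanSpace_single_eq_smul, Finset.sum_smul]
  refine Finset.sum_congr rfl fun i _ => ?_
  rw [← euclideanSpace_single_eq_smul]
  refine Eq.trans ?_ (tensorAt_single (e₁ := LionsWord.headEmb i) (e₂ := LionsWord.tailEmb i)
    (fun k => ?_) W.letter _ _)
  · exact congrArg₂ (tensorAt (LionsWord.headEmb i) (LionsWord.tailEmb i))
      (wordInt_sub W (LionsWord.headEmb i) s t x y) (wordInt_sub W (LionsWord.tailEmb i) t u x y)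
  · have hk := k.2
    rcases lt_or_ge (k : ℕ) i with h | h
    · exact Or.inl ⟨⟨k, h⟩, rfl⟩
    · exact Or.inr ⟨⟨k - i, by omega⟩, Fin.ext (Nat.add_sub_of_le h)⟩

theorem iteratedIntegralRelations_wordInt : IteratedIntegralRelations (wordInt (d := d)) where
  single i s t x y := by
    have h : iterInt 1 (fun _ : Fin 1 => i) (driver (LionsWord.single i) x y) s t =
        x.path t i - x.path s i := by
      rw [← x.integral_vel i s t]
      refine intervalIntegral.integral_congr fun r _ => ?_
      dsimp only
      rw [driver_of_mem_p0 (W := LionsWord.single i) (k := Fin.last 0) (Finset.mem_univ _)]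
      exact one_mul _
    rw [← h]
    rfl
  shuffle := wordInt_shuffle
  map_E W h s t := wordInt_E W h s t
  graft W i s t x y := by
    have hd : driver (W.graft i) x y =
        Fin.append (driver W x fun p => y (W.inl (LionsWord.single i) p)) (fun _ : Fin 1 => x) := by
      refine driver_concat.trans ?_
      congr 1
      funext k
      exact driver_of_mem_p0 (Finset.mem_univ _)
    have hl : (Fin.append W.letter fun _ : Fin 1 => i) ∘ Fin.castAdd 1 = W.letter := by
      funext k; simp
    have hr : (Fin.append W.letter fun _ : Fin 1 => i) ∘ Fin.natAdd W.len = fun _ => i := by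
      funext k; simp
    have hrhs : ∀ c c' : ℝ, tensorAt (Fin.castAdd 1) (Fin.natAdd W.len)
        (EuclideanSpace.single W.letter c) (EuclideanSpace.single (fun _ : Fin 1 => i) c') =
        (c * c') • (EuclideanSpace.single (Fin.append W.letter fun _ : Fin 1 => i) 1 :
          Tens d (W.len + 1)) := by
      intro c c'
      have := tensorAt_single (d := d) (e₁ := Fin.castAdd 1) (e₂ := Fin.natAdd W.len)
        (fun k => Fin.addCases (fun a => Or.inl ⟨a, rfl⟩) (fun b => Or.inr ⟨b, rfl⟩) k)
        (Fin.append W.letter fun _ : Fin 1 => i) c c'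
      rw [hl, hr] at this
      rw [this, euclideanSpace_single_eq_smul]
    simp only [wordInt, hd]
    refine Eq.trans ?_ (intervalIntegral.integral_congr (g := fun r =>
      (iterInt W.len W.letter (driver W x fun p => y (W.inl (LionsWord.single i) p)) s r *
        x.vel r i) • (EuclideanSpace.single (Fin.append W.letter fun _ : Fin 1 => i) 1 :
          Tens d (W.len + 1))) fun r _ => hrhs _ _).symm
    rw [intervalIntegral.integral_smul_const, ← euclideanSpace_single_eq_smul]
    have key : iterInt (W.len + 1) (Fin.append W.letter fun _ : Fin 1 => i)
        (Fin.append (driver W x fun p => y (W.inl (LionsWord.single i) p)) (fun _ : Fin 1 => x)) s t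
        = ∫ r in (s : ℝ)..t, iterInt W.len W.letter
          (driver W x fun p => y (W.inl (LionsWord.single i) p)) s r * x.vel r i := by
      have h1 : ∀ {A : Type} (f : Fin W.len → A) (a : A),
          Fin.init (Fin.append f fun _ : Fin 1 => a) = f := fun f a => by
        funext k; exact Fin.append_left f (fun _ : Fin 1 => a) k
      have h2 : ∀ {A : Type} (f : Fin W.len → A) (a : A),
          Fin.append f (fun _ : Fin 1 => a) (Fin.last W.len) = a := fun f a =>
        Fin.append_right f (fun _ : Fin 1 => a) 0
      rw [iterInt]
      simp only [h1, h2]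
    rw [← key]
    rfl

/-! ### The grading -/

namespace LionsWord

variable {d : ℕ} {α β : ℝ}

theorem card_p0_add_card_compl (W : LionsWord d) : (#W.p0 : ℝ) + (#(W.p0ᶜ) : ℝ) = W.len := by
  rw [← Nat.cast_add, Finset.card_add_card_compl, Fintype.card_fin]

theorem grade_nonneg (hα : 0 < α) (hβ : 0 < β) (W : LionsWord d) : 0 ≤ W.grade α β := by
  unfold grade; positivity

/-- Bounds the length of truncated words by `γ / (α ∧ β)`, hence by `q'`. -/
theorem min_mul_len_le_grade (W : LionsWord d) : min α β * W.len ≤ W.grade α β := by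
  rw [← W.card_p0_add_card_compl, grade, mul_add]
  gcongr
  · exact min_le_left _ _
  · exact min_le_right _ _

theorem grade_one : (one d).grade α β = 0 := by
  have h : (one d).p0 = ∅ := rfl
  have h' : (one d).p0ᶜ = ∅ := rfl
  rw [grade, h', h]
  simp

theorem grade_single (i : Fin d) : (single i).grade α β = α := by
  have h1 : #(single i).p0 = 1 := rfl
  have h2 : #((single i).p0ᶜ) = 0 := rfl
  rw [grade, h1, h2]
  simp

theorem grade_E_single (i : Fin d) : (single i).E.grade α β = β := by
  have h1 : #(single i).E.p0 = 0 := rfl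
  have h2 : #((single i).E.p0ᶜ) = 1 := rfl
  rw [grade, h1, h2]
  simp

/-- Makes truncation stable under heads, tails and shuffles. -/
theorem grade_sub_le (hα : 0 < α) (hβ : 0 < β) (W : LionsWord d) {m : ℕ} (e : Fin m ↪ Fin W.len) :
    (W.sub e).grade α β ≤ W.grade α β := by
  have h1 : #(W.sub e).p0 ≤ #W.p0 :=
    Finset.card_le_card_of_injOn e (fun k hk => (mem_sub_p0 W e k).1 hk) e.injective.injOn
  have h2 : #((W.sub e).p0ᶜ) ≤ #(W.p0ᶜ) :=
    Finset.card_le_card_of_injOn e (fun k hk => Finset.mem_coe.2 <| Finset.mem_compl.2 fun h =>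
      Finset.mem_compl.1 hk ((mem_sub_p0 W e k).2 h)) e.injective.injOn
  unfold grade
  gcongr

theorem grade_concat (W₁ W₂ : LionsWord d) :
    (W₁.concat W₂).grade α β = W₁.grade α β + W₂.grade α β := by
  have h1 : #(W₁.concat W₂).p0 = #W₁.p0 + #W₂.p0 := by
    have h : Disjoint (W₁.p0.map (Fin.castAddEmb W₂.len)) (W₂.p0.map (Fin.natAddEmb W₁.len)) := by
      rw [Finset.disjoint_left]
      intro k hk
      obtain ⟨a, -, rfl⟩ := Finset.mem_map.1 hk
      exact castAdd_notMem a _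
    refine (Finset.card_union_of_disjoint h).trans ?_
    rw [Finset.card_map, Finset.card_map]
  have h2 := W₁.card_p0_add_card_compl
  have h3 := W₂.card_p0_add_card_compl
  have h4 := (W₁.concat W₂).card_p0_add_card_compl
  have h5 : ((W₁.concat W₂).len : ℝ) = W₁.len + W₂.len := Nat.cast_add _ _
  have h6 : (#(W₁.concat W₂).p0 : ℝ) = #W₁.p0 + #W₂.p0 := by rw [h1, Nat.cast_add]
  unfold grade
  rw [h6, show (#((W₁.concat W₂).p0ᶜ) : ℝ) = #(W₁.p0ᶜ) + #(W₂.p0ᶜ) by linarith]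
  ring

/-- Words with all letters tagged; they serve as competitors in the infimum defining `γ`. -/
theorem exists_grade_eq_mul (i : Fin d) (k : ℕ) :
    ∃ W : LionsWord d, W.len ≠ 0 ∧ W.grade α β = (k + 1) * α := by
  induction k with
  | zero => exact ⟨single i, one_ne_zero, by rw [grade_single]; simp⟩
  | succ k ih =>
    obtain ⟨W, -, h⟩ := ih
    refine ⟨W.graft i, Nat.succ_ne_zero W.len, ?_⟩
    rw [graft, grade_concat, h, grade_single]
    push_cast
    ring

theorem critGrade_le (hα : 0 < α) (hβ : 0 < β) {W : LionsWord d} (hW : W.len ≠ 0)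
    (h : 1 - α < W.grade α β) : critGrade d α β ≤ W.grade α β :=
  csInf_le ⟨0, by rintro _ ⟨W, -, -, rfl⟩; exact W.grade_nonneg hα hβ⟩ ⟨W, hW, h, rfl⟩

theorem min_le_critGrade (hd : 0 < d) (hα : 0 < α) (hβ : 0 < β) :
    min α β ≤ critGrade d α β := by
  -- Nonemptiness has content: for `d = 0` the infimum would be `sInf ∅ = 0`.
  refine le_csInf ?_ ?_
  · obtain ⟨k, hk⟩ := exists_nat_gt (1 / α)
    obtain ⟨W, hW, h⟩ := exists_grade_eq_mul (α := α) (β := β) (⟨0, hd⟩ : Fin d) k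
    refine ⟨_, W, hW, ?_, rfl⟩
    rw [div_lt_iff₀ hα] at hk
    rw [h]
    nlinarith
  · rintro _ ⟨W, hW, -, rfl⟩
    have h1 : (1 : ℝ) ≤ W.len := Nat.one_le_cast.2 (Nat.one_le_iff_ne_zero.2 hW)
    have h2 : 0 < min α β := lt_min hα hβ
    exact (le_mul_of_one_le_right h2.le h1).trans W.min_mul_len_le_grade

/-- If `α ∧ β ≤ 1`, the grade of a word of the truncated set is at most its length. -/
theorem grade_le_len (hd : 0 < d) (hα : 0 < α) (hβ : 0 < β) (h1 : min α β ≤ 1) {W : LionsWord d}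
    (hW : W ∈ trunc d α β (critGrade d α β)) : W.grade α β ≤ W.len := by
  have hW' : W.grade α β ≤ critGrade d α β := hW
  have hlen := W.card_p0_add_card_compl
  have hp : (0 : ℝ) ≤ #W.p0 := Nat.cast_nonneg _
  have hq : (0 : ℝ) ≤ #(W.p0ᶜ) := Nat.cast_nonneg _
  rcases le_or_gt α 1 with ha | ha
  · rcases le_or_gt β 1 with hb | hb
    · unfold grade
      nlinarith
    · have hk : 1 ≤ ⌊1 / α⌋₊ := Nat.le_floor (by rw [Nat.cast_one, le_div_iff₀ hα]; linarith)
      obtain ⟨V, hV, hg⟩ := exists_grade_eq_mul (α := α) (β := β) (⟨0, hd⟩ : Fin d) (⌊1 / α⌋₊ - 1)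
      rw [Nat.cast_sub hk, Nat.cast_one, sub_add_cancel] at hg
      have hle : (⌊1 / α⌋₊ : ℝ) * α ≤ 1 := by
        rw [← le_div_iff₀ hα]; exact Nat.floor_le (by positivity)
      have hlt : 1 < (⌊1 / α⌋₊ + 1 : ℝ) * α := by
        rw [← div_lt_iff₀ hα]; exact Nat.lt_floor_add_one _
      have hc := critGrade_le hα hβ hV (by rw [hg]; linarith)
      have hcard : #(W.p0ᶜ) = 0 := by
        by_contra h
        have h' : (1 : ℝ) ≤ #(W.p0ᶜ) := Nat.one_le_cast.2 (Nat.one_le_iff_ne_zero.2 h)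
        have hg' : W.grade α β ≤ 1 := by linarith
        unfold grade at hg'
        nlinarith
      rw [hcard, Nat.cast_zero, add_zero] at hlen
      rw [grade, hcard, ← hlen]
      simp only [Nat.cast_zero, mul_zero, add_zero]
      nlinarith
  · have hb : β ≤ 1 := by
      rcases min_le_iff.1 h1 with h | h
      · linarith
      · exact h
    -- Here `1 - α < 0`, so a single untagged letter competes and `γ ≤ β ≤ 1`, which is at most the
    -- length of any non-empty word.
    have hc := critGrade_le (d := d) hα hβ (W := (single ⟨0, hd⟩).E) one_ne_zero
      (by rw [grade_E_single]; linarith)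
    rw [grade_E_single] at hc
    by_cases h0 : W.len = 0
    · have h0' : (W.len : ℝ) = 0 := by rw [h0, Nat.cast_zero]
      have e1 : (#W.p0 : ℝ) = 0 := by linarith
      have e2 : (#(W.p0ᶜ) : ℝ) = 0 := by linarith
      rw [grade, e1, e2, h0']
      simp
    · have : (1 : ℝ) ≤ W.len := Nat.one_le_cast.2 (Nat.one_le_iff_ne_zero.2 h0)
      linarith

end LionsWord

/-! ### The lift of `μ`: measurability, character property, convolution -/

section pathLift

variable {d : ℕ} {α β γ : ℝ} {μ : Measure (C1Path d)}

theorem pathLift_of_mem {W : LionsWord d} (hW : W ∈ LionsWord.trunc d α β γ) (s t : unitInterval)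
    (ω : μ.support × (W.Block → μ.support)) :
    pathLift α β γ μ s t W ω = wordInt W s t (ω.1 : C1Path d) (fun p => (ω.2 p : C1Path d)) :=
  if_pos hW

theorem pathLift_of_notMem {W : LionsWord d} (hW : W ∉ LionsWord.trunc d α β γ)
    (s t : unitInterval) : pathLift α β γ μ s t W = 0 :=
  funext fun _ => if_neg hW

theorem continuous_pathLift (W : LionsWord d) (s t : unitInterval) :
    Continuous (pathLift α β γ μ s t W) := by
  by_cases hW : W ∈ LionsWord.trunc d α β γ
  · have h : ∀ ω, pathLift α β γ μ s t W ω =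
        iterInt W.len W.letter (driver W ω.1 fun p => (ω.2 p : C1Path d)) s t •
          (EuclideanSpace.single W.letter 1 : Tens d W.len) := fun ω => by
      rw [pathLift_of_mem hW, wordInt, euclideanSpace_single_eq_smul]
    rw [funext h]
    refine Continuous.smul (M := ℝ) ?_ continuous_const
    have hval : Continuous fun ω : μ.support × (W.Block → μ.support) =>
        ((ω.1 : C1Path d), fun p => (ω.2 p : C1Path d)) :=
      (continuous_subtype_val.comp continuous_fst).prodMk (continuous_pi fun p =>
        continuous_subtype_val.comp ((continuous_apply p).comp continuous_snd))
    exact (continuous_iterInt W.letter s t).comp ((continuous_driver W).comp hval)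
  · rw [pathLift_of_notMem hW]
    exact continuous_const

theorem measurable_pathLift (W : LionsWord d) (s t : unitInterval) :
    Measurable (pathLift α β γ μ s t W) :=
  (continuous_pathLift W s t).measurable

theorem isMcKeanVlasovCharacter_pathLift (hα : 0 < α) (hβ : 0 < β) (hγ : 0 ≤ γ)
    (s t : unitInterval) :
    IsMcKeanVlasovCharacter α β γ (supportMeasure μ) (pathLift α β γ μ s t) where
  measurable W := measurable_pathLift W s t
  eq_zero W hW := pathLift_of_notMem hW s t
  map_one := by
    refine Filter.Eventually.of_forall fun ω => ?_
    rw [pathLift_of_mem (show (LionsWord.one d).grade α β ≤ γ from LionsWord.grade_one.trans_le hγ)]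
    rfl
  map_shuffle W₁ W₂ hW := by
    have hW' : (W₁.concat W₂).grade α β ≤ γ := hW
    have hg := LionsWord.grade_concat (α := α) (β := β) W₁ W₂
    have h1 : W₁ ∈ LionsWord.trunc d α β γ := show W₁.grade α β ≤ γ by
      linarith [W₂.grade_nonneg hα hβ]
    have h2 : W₂ ∈ LionsWord.trunc d α β γ := show W₂.grade α β ≤ γ by
      linarith [W₁.grade_nonneg hα hβ]
    have h3 : ∀ σ, W₁.shuffleTerm W₂ σ ∈ LionsWord.trunc d α β γ := fun σ =>
      (LionsWord.grade_sub_le hα hβ (W₁.concat W₂) σ.toEmbedding).trans hW'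
    refine Filter.Eventually.of_forall fun ω => ?_
    simp only [pathLift_of_mem h1, pathLift_of_mem h2, pathLift_of_mem (h3 _)]
    exact wordInt_shuffle W₁ W₂ s t ω.1 fun p => (ω.2 p : C1Path d)
  map_E W h hW hE := by
    refine Filter.Eventually.of_forall fun ω => ?_
    rw [pathLift_of_mem hW, pathLift_of_mem hE]
    exact (wordInt_E W h s t ω.1 fun p => (ω.2 p : C1Path d)).symm

theorem conv_pathLift (hα : 0 < α) (hβ : 0 < β) (s t u : unitInterval) (W : LionsWord d)
    (ω : μ.support × (W.Block → μ.support)) :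
    conv α β γ (pathLift α β γ μ s t) (pathLift α β γ μ t u) W ω = pathLift α β γ μ s u W ω := by
  by_cases hW : W ∈ LionsWord.trunc d α β γ
  · rw [conv, if_pos hW, pathLift_of_mem hW,
      ← wordInt_chen W s t u ω.1 fun p => (ω.2 p : C1Path d)]
    refine Finset.sum_congr rfl fun i _ => ?_
    rw [coupledTerm,
      pathLift_of_mem (W := W.head i) ((LionsWord.grade_sub_le hα hβ W _).trans hW),
      pathLift_of_mem (W := W.tail i) ((LionsWord.grade_sub_le hα hβ W _).trans hW)]
  · rw [conv, if_neg hW, pathLift_of_notMem hW]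
    rfl

end pathLift

/-! ### Dual pairs -/

theorem LionsWord.len_le_of_mem_trunc {d : ℕ} {α β γ q' : ℝ} (hα : 0 < α) (hβ : 0 < β)
    (hq' : (⌊γ / min α β⌋ : ℝ) ≤ q') {W : LionsWord d} (hW : W ∈ LionsWord.trunc d α β γ) :
    (W.len : ℝ) ≤ q' := by
  refine le_trans ?_ hq'
  have h : ((W.len : ℤ) : ℝ) ≤ γ / min α β := by
    rw [le_div_iff₀ (lt_min hα hβ), mul_comm, Int.cast_natCast]
    exact W.min_mul_len_le_grade.trans hW
  exact_mod_cast Int.le_floor.2 h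

theorem exists_isDualPair {d : ℕ} {α β γ q' : ℝ} (hq : 1 ≤ q')
    (hlen : ∀ W ∈ LionsWord.trunc d α β γ, (W.len : ℝ) ≤ q') :
    ∃ p : LionsWord d → ℝ≥0∞, IsDualPair d α β γ p (fun W => q' / W.len) := by
  have hq0 : 0 < q' := zero_lt_one.trans_le hq
  -- Normalising `p[𝟏] = 1`, duality forces `1/p[W] = 1 - |w|/q'`; thus `p[W] = ∞` when `|w| = q'`.
  -- The coproduct condition holds with equality.
  refine ⟨fun W => (ENNReal.ofReal (1 - W.len / q'))⁻¹, ?_, ?_, ?_, ?_, ?_, ?_⟩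
  · intro W _
    rw [ENNReal.one_le_inv, ENNReal.ofReal_le_one]
    have : 0 ≤ W.len / q' := by positivity
    linarith
  · intro W hW h
    have h0 : (0 : ℝ) < W.len := Nat.cast_pos.2 (Nat.pos_of_ne_zero h)
    exact (one_le_div h0).2 (hlen W hW)
  · intro W hW h
    have h0 : (0 : ℝ) < W.len := Nat.cast_pos.2 (Nat.pos_of_ne_zero h)
    have h1 : (W.len : ℝ) / q' ≤ 1 := (div_le_one hq0).2 (hlen W hW)
    have h2 : (LionsWord.one d).len = 0 := rfl
    simp only [inv_inv, h2]
    rw [← ENNReal.ofReal_inv_of_pos (by positivity), inv_div,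
      ← ENNReal.ofReal_add (by linarith) (by positivity)]
    simp
  · intro W _ i _ _
    have hi : (i : ℕ) ≤ W.len := Nat.lt_succ_iff.1 i.2
    have h1 : (W.head i).len = i := rfl
    have h2 : (W.tail i).len = W.len - i := rfl
    simp only [h1, h2, one_div_div]
    rw [← add_div, Nat.cast_sub hi, add_sub_cancel]
  · intro W _ _ _
    rfl
  · intro W₁ W₂ _ _ _ σ _
    have h : (W₁.shuffleTerm W₂ σ).len = W₁.len + W₂.len := rfl
    simp only [h, one_div_div]
    rw [Nat.cast_add, add_div]

/-! ### Moments -/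

theorem abs_sub_unitInterval_le_one (t s : unitInterval) : |(t : ℝ) - s| ≤ 1 :=
  abs_sub_le_iff.2 ⟨by linarith [t.2.2, s.2.1], by linarith [s.2.2, t.2.1]⟩

/-- Fatou's lemma: an integral is lower semicontinuous in a parameter. -/
theorem lowerSemicontinuous_lintegral {X Y : Type*} [TopologicalSpace X]
    [FirstCountableTopology X] [MeasurableSpace Y] {ν : Measure Y} {f : X → Y → ℝ≥0∞}
    (hm : ∀ x, Measurable (f x)) (hc : ∀ y, Continuous fun x => f x y) :
    LowerSemicontinuous fun x => ∫⁻ y, f x y ∂ν := by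
  intro x c hcx
  by_contra h
  -- First countability supplies a sequence tending to `x` along which the integrals stay at most
  -- `c`; Fatou then contradicts `c < ∫⁻ f x`.
  obtain ⟨z, hz, hzc⟩ := Filter.exists_seq_forall_of_frequently (Filter.not_eventually.1 h)
  refine absurd hcx (not_lt.2 ?_)
  have h1 : ∀ y, f x y = Filter.liminf (fun n => f (z n) y) Filter.atTop := fun y =>
    ((((hc y).tendsto x).comp hz).liminf_eq).symm
  simp only [h1]
  refine (lintegral_liminf_le fun n => hm (z n)).trans ?_
  exact Filter.liminf_le_of_frequently_le'
    (Filter.Frequently.of_forall fun n => not_lt.1 (hzc n))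

/-- The product of norms is bounded by the power of the largest one, and the `q'`-th power of a
maximum by the sum. No independence of the paths enters. -/
theorem norm_wordInt_rpow_le {d : ℕ} {W : LionsWord d} (hW : W.len ≠ 0) {q' : ℝ} (hq : 0 < q')
    (s t : unitInterval) (x : C1Path d) (y : W.Block → C1Path d) :
    ‖wordInt W s t x y‖ ^ (q' / W.len) ≤
      |(t : ℝ) - s| ^ q' * ∑ k, ‖driver W x y k‖ ^ q' := by
  have hn : (0 : ℝ) < W.len := Nat.cast_pos.2 (Nat.pos_of_ne_zero hW)
  have : Nonempty (Fin W.len) := ⟨⟨0, Nat.pos_of_ne_zero hW⟩⟩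
  obtain ⟨k₀, -, hk₀⟩ := Finset.exists_max_image Finset.univ (fun k => ‖driver W x y k‖)
    Finset.univ_nonempty
  have h1 : ‖wordInt W s t x y‖ ≤ (‖driver W x y k₀‖ * |(t : ℝ) - s|) ^ W.len := by
    rw [wordInt, PiLp.norm_single, Real.norm_eq_abs, mul_pow]
    refine (abs_iterInt_le _ _ s t).trans ?_
    gcongr
    refine (Finset.prod_le_prod (fun k _ => norm_nonneg _) hk₀).trans_eq ?_
    simp
  calc ‖wordInt W s t x y‖ ^ (q' / W.len)
      ≤ ((‖driver W x y k₀‖ * |(t : ℝ) - s|) ^ W.len) ^ (q' / W.len) := by gcongr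
    _ = |(t : ℝ) - s| ^ q' * ‖driver W x y k₀‖ ^ q' := by
        rw [← Real.rpow_natCast, ← Real.rpow_mul (by positivity), mul_div_cancel₀ _ hn.ne',
          Real.mul_rpow (norm_nonneg _) (abs_nonneg _), mul_comm]
    _ ≤ _ := by
        gcongr
        exact Finset.single_le_sum (f := fun k => ‖driver W x y k‖ ^ q')
          (fun k _ => by positivity) (Finset.mem_univ k₀)

theorem enorm_wordInt_rpow_le {d : ℕ} {W : LionsWord d} (hW : W.len ≠ 0) {q' : ℝ} (hq : 0 < q')
    (s t : unitInterval) (x : C1Path d) (y : W.Block → C1Path d) :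
    ‖wordInt W s t x y‖ₑ ^ (q' / W.len) ≤
      ENNReal.ofReal (|(t : ℝ) - s| ^ q') * ∑ k, ‖driver W x y k‖ₑ ^ q' := by
  have h : ∀ k, ‖driver W x y k‖ₑ ^ q' = ENNReal.ofReal (‖driver W x y k‖ ^ q') := fun k => by
    rw [← ofReal_norm, ENNReal.ofReal_rpow_of_nonneg (norm_nonneg _) hq.le]
  simp only [h]
  rw [← ofReal_norm, ENNReal.ofReal_rpow_of_nonneg (norm_nonneg _) (by positivity),
    ← ENNReal.ofReal_sum_of_nonneg (fun k _ => by positivity), ← ENNReal.ofReal_mul (by positivity)]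
  exact ENNReal.ofReal_le_ofReal (norm_wordInt_rpow_le hW hq s t x y)

/-- The bound for the conditional moments of the iterated integrals. -/
def momentBound {d : ℕ} (μ : Measure (C1Path d)) (W : LionsWord d) (q' : ℝ) (x : μ.support) :
    ℝ≥0∞ :=
  ∑ k, if k ∈ W.p0 then ‖(x : C1Path d)‖ₑ ^ q'
    else ∫⁻ z : μ.support, ‖(z : C1Path d)‖ₑ ^ q' ∂(supportMeasure μ)

section moments

variable {d : ℕ} {α β γ : ℝ} {μ : Measure (C1Path d)} {W : LionsWord d} {q' : ℝ}

theorem measurable_enorm_rpow :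
    Measurable fun z : μ.support => ‖(z : C1Path d)‖ₑ ^ q' :=
  measurable_subtype_coe.enorm.pow_const q'

theorem lintegral_support_lt_top (hμ : ∫⁻ x, ‖x‖ₑ ^ q' ∂μ < ∞) :
    ∫⁻ z : μ.support, ‖(z : C1Path d)‖ₑ ^ q' ∂(supportMeasure μ) < ∞ := by
  rw [supportMeasure, lintegral_subtype_comap Measure.isClosed_support.measurableSet
    (fun z : C1Path d => ‖z‖ₑ ^ q')]
  exact (setLIntegral_le_lintegral _ _).trans_lt hμ

/-- Each quotient is lower semicontinuous in `x` by Fatou, and lower semicontinuity survives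
arbitrary suprema, so no countable reduction of the times is needed. -/
theorem measurable_condMoment_sup (g : ℝ) :
    Measurable fun x : μ.support => ⨆ (s : unitInterval) (t : unitInterval) (_ : s ≠ t),
      condMoment (supportMeasure μ) (pathLift α β γ μ s t) W (q' / W.len) x /
        ENNReal.ofReal (|(t : ℝ) - s| ^ g) := by
  refine LowerSemicontinuous.measurable ?_
  refine lowerSemicontinuous_iSup fun s => lowerSemicontinuous_iSup fun t =>
    lowerSemicontinuous_iSup fun hst => ?_
  have hpos : 0 < |(t : ℝ) - s| := abs_pos.2 (sub_ne_zero.2 fun h => hst (Subtype.ext h.symm))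
  have hc := (continuous_pathLift (α := α) (β := β) (γ := γ) (μ := μ) W s t)
  have hpow : Continuous fun a : ℝ≥0∞ => a ^ (q' / W.len) := ENNReal.continuous_rpow_const
  refine Continuous.comp_lowerSemicontinuous (g := fun a : ℝ≥0∞ =>
    a / ENNReal.ofReal (|(t : ℝ) - s| ^ g)) (ENNReal.continuous_div_const _ ?_)
    (lowerSemicontinuous_lintegral (fun x => ?_) fun y => ?_)
    fun a b hab => ENNReal.div_le_div_right hab _
  · exact (ENNReal.ofReal_pos.2 (Real.rpow_pos_of_pos hpos _)).ne'
  · exact ((measurable_pathLift W s t).comp measurable_prodMk_left).enorm.pow_const _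
  · exact hpow.comp (hc.comp (Continuous.prodMk_left y)).enorm

variable [IsProbabilityMeasure μ]

/-- Integrating the pointwise bound over the block variables leaves tagged letters untouched and
turns each other letter into the `q'`-th moment of `μ`, as coordinates of the product measure have
law `μ`. -/
theorem condMoment_pathLift_le (hW : W ∈ LionsWord.trunc d α β γ) (hlen : W.len ≠ 0) (hq : 0 < q')
    (s t : unitInterval) (x : μ.support) :
    condMoment (supportMeasure μ) (pathLift α β γ μ s t) W (q' / W.len) x ≤
      ENNReal.ofReal (|(t : ℝ) - s| ^ q') * momentBound μ W q' x := by
  have hd : ∀ k, Measurable fun ω : W.Block → μ.support =>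
      ‖driver W (x : C1Path d) (fun p => (ω p : C1Path d)) k‖ₑ ^ q' := by
    intro k
    by_cases hk : k ∈ W.p0
    · simp only [driver_of_mem_p0 hk]
      exact measurable_const
    · obtain ⟨p, hp⟩ := exists_block hk
      simp only [driver_of_mem_block hp]
      exact measurable_enorm_rpow.comp (measurable_pi_apply p)
  unfold condMoment
  simp only [pathLift_of_mem hW]
  refine (lintegral_mono fun ω => enorm_wordInt_rpow_le hlen hq s t _ _).trans_eq ?_
  rw [lintegral_const_mul _ (Finset.measurable_fun_sum _ fun k _ => hd k),
    lintegral_finsetSum _ fun k _ => hd k, momentBound]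
  congr 1
  refine Finset.sum_congr rfl fun k _ => ?_
  by_cases hk : k ∈ W.p0
  · simp only [driver_of_mem_p0 hk, if_pos hk]
    simp
  · obtain ⟨p, hp⟩ := exists_block hk
    simp only [driver_of_mem_block hp, if_neg hk]
    exact (measurePreserving_eval (fun _ : W.Block => supportMeasure μ) p).lintegral_comp
      measurable_enorm_rpow

theorem lintegral_momentBound :
    ∫⁻ x, momentBound μ W q' x ∂(supportMeasure μ) =
      W.len * ∫⁻ z : μ.support, ‖(z : C1Path d)‖ₑ ^ q' ∂(supportMeasure μ) := by
  unfold momentBound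
  rw [lintegral_finsetSum]
  · rw [Finset.sum_congr rfl (g := fun _ =>
      ∫⁻ z : μ.support, ‖(z : C1Path d)‖ₑ ^ q' ∂(supportMeasure μ))]
    · simp
    · intro k _
      by_cases hk : k ∈ W.p0
      · simp only [if_pos hk]
      · simp only [if_neg hk]
        simp
  · intro k _
    by_cases hk : k ∈ W.p0
    · simp only [if_pos hk]
      exact measurable_enorm_rpow
    · simp only [if_neg hk]
      exact measurable_const

theorem lintegral_enorm_pathLift_lt_top (hμ : ∫⁻ x, ‖x‖ₑ ^ q' ∂μ < ∞)
    (hW : W ∈ LionsWord.trunc d α β γ) (hlen : W.len ≠ 0) (hq : 0 < q') (s t : unitInterval) :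
    ∫⁻ ω, ‖pathLift α β γ μ s t W ω‖ₑ ^ (q' / W.len) ∂(blockMeasure (supportMeasure μ) W) < ∞ := by
  rw [blockMeasure, lintegral_prod _ ((measurable_pathLift W s t).enorm.pow_const _).aemeasurable]
  refine (lintegral_mono fun x => condMoment_pathLift_le hW hlen hq s t x).trans_lt ?_
  rw [lintegral_const_mul' _ _ ENNReal.ofReal_ne_top, lintegral_momentBound]
  exact ENNReal.mul_lt_top ENNReal.ofReal_lt_top
    (ENNReal.mul_lt_top (ENNReal.natCast_lt_top _) (lintegral_support_lt_top hμ))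

end moments

/-! ### The rough path property and the main theorem -/

theorem isProbabilisticRoughPath_pathLift {d : ℕ} {α β γ q' : ℝ} (hα : 0 < α) (hβ : 0 < β)
    (hγ : 0 ≤ γ) (hq : 0 < q') {μ : Measure (C1Path d)} [IsProbabilityMeasure μ]
    (hμ : ∫⁻ x, ‖x‖ₑ ^ q' ∂μ < ∞)
    (hgrade : ∀ W ∈ LionsWord.trunc d α β γ, W.grade α β ≤ W.len)
    {p : LionsWord d → ℝ≥0∞} (hp : IsDualPair d α β γ p (fun W => q' / W.len)) :
    IsProbabilisticRoughPath α β γ p (fun W => q' / W.len) (supportMeasure μ)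
      (pathLift α β γ μ) where
  dual := hp
  character := isMcKeanVlasovCharacter_pathLift hα hβ hγ
  moment s t W hW hlen := by
    have h0 : 0 < q' / W.len := div_pos hq (Nat.cast_pos.2 (Nat.pos_of_ne_zero hlen))
    refine ⟨(continuous_pathLift W s t).aestronglyMeasurable, ?_⟩
    rw [eLpNorm_lt_top_iff_lintegral_rpow_enorm_lt_top (ENNReal.ofReal_pos.2 h0).ne'
      ENNReal.ofReal_ne_top, ENNReal.toReal_ofReal h0.le]
    exact lintegral_enorm_pathLift_lt_top hμ hW hlen hq s t
  chen s t u W _ := Filter.Eventually.of_forall fun ω => conv_pathLift hα hβ s t u W ω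
  regular_tagged W hW hp0 := by
    have hlen : W.len ≠ 0 := by
      obtain ⟨k, -⟩ := Finset.nonempty_iff_ne_empty.2 hp0
      have := k.2
      omega
    refine ⟨(measurable_condMoment_sup _).aemeasurable, ?_⟩
    refine (lintegral_mono (g := momentBound μ W q') fun x => ?_).trans_lt ?_
    · refine iSup_le fun s => iSup_le fun t => iSup_le fun hst => ENNReal.div_le_of_le_mul ?_
      refine (condMoment_pathLift_le hW hlen hq s t x).trans ?_
      rw [mul_comm]
      refine mul_le_mul' le_rfl (ENNReal.ofReal_le_ofReal ?_)
      have hpos : 0 < |(t : ℝ) - s| := abs_pos.2 (sub_ne_zero.2 fun h => hst (Subtype.ext h.symm))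
      -- The required exponent is `q' 𝒢[W] / |w| ≤ q'`, and powers of a base at most `1` decrease in
      -- the exponent.
      refine Real.rpow_le_rpow_of_exponent_ge hpos (abs_sub_unitInterval_le_one t s) ?_
      have hn : (0 : ℝ) < W.len := Nat.cast_pos.2 (Nat.pos_of_ne_zero hlen)
      rw [div_mul_eq_mul_div, div_le_iff₀ hn]
      exact mul_le_mul_of_nonneg_left (hgrade W hW) hq.le
    · rw [lintegral_momentBound]
      exact ENNReal.mul_lt_top (ENNReal.natCast_lt_top _) (lintegral_support_lt_top hμ)
  regular_untagged W hW hlen hp0 := by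
    have hn : (0 : ℝ) < W.len := Nat.cast_pos.2 (Nat.pos_of_ne_zero hlen)
    have h0 : 0 < q' / W.len := div_pos hq hn
    set M := ∫⁻ z : μ.support, ‖(z : C1Path d)‖ₑ ^ q' ∂(supportMeasure μ) with hM
    have hfin : (W.len * M : ℝ≥0∞) ≠ ∞ :=
      (ENNReal.mul_lt_top (ENNReal.natCast_lt_top _) (lintegral_support_lt_top hμ)).ne
    have hB : ∀ x, momentBound μ W q' x = W.len * M := fun x => by
      simp [momentBound, hp0, hM]
    set D := (W.len * M : ℝ≥0∞).toReal with hD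
    have hD0 : 0 ≤ D := ENNReal.toReal_nonneg
    -- Without tagged letters the moment bound is the constant `D`; adding `1` only keeps the
    -- constant positive.
    refine ⟨D ^ (1 / (q' / W.len)) + 1, by positivity, fun s t => Filter.Eventually.of_forall
      fun x => ?_⟩
    have hts := abs_nonneg ((t : ℝ) - s)
    have h1 := condMoment_pathLift_le hW hlen hq s t x
    rw [hB, ← ENNReal.ofReal_toReal hfin, ← hD, ← ENNReal.ofReal_mul (by positivity)] at h1
    refine (ENNReal.rpow_le_rpow h1 (by positivity)).trans ?_
    rw [ENNReal.ofReal_rpow_of_nonneg (by positivity) (by positivity)]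
    refine ENNReal.ofReal_le_ofReal ?_
    rw [Real.mul_rpow (by positivity) hD0, ← Real.rpow_mul hts, mul_comm, one_div_div,
      mul_div_cancel₀ _ hq.ne']
    -- The case `s = t` is included: the base is then `0`, and the left side vanishes because `|w| ≠
    -- 0`.
    have h2 : |(t : ℝ) - s| ^ (W.len : ℝ) ≤ |(t : ℝ) - s| ^ W.grade α β :=
      Real.rpow_le_rpow_of_exponent_ge_of_imp hts (abs_sub_unitInterval_le_one t s)
        (hgrade W hW) fun _ h => absurd h hn.ne'
    gcongr
    linarith

end

theorem mainTheorem11 {d : ℕ} (hd : 0 < d) {α β γ : ℝ} (hα : 0 < α) (hβ : 0 < β)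
    (hγ : γ = LionsWord.critGrade d α β) {q' : ℝ} (hq' : (⌊γ / min α β⌋ : ℝ) ≤ q')
    (μ : Measure (C1Path d)) [IsProbabilityMeasure μ] (hμ : ∫⁻ x, ‖x‖ₑ ^ q' ∂μ < ∞) :
    IteratedIntegralRelations (wordInt (d := d)) ∧
    (∀ s t : unitInterval,
      IsMcKeanVlasovCharacter α β γ (supportMeasure μ) (pathLift α β γ μ s t)) ∧
    (∀ (s t u : unitInterval) (x : μ.support) (W : LionsWord d) (y : W.Block → μ.support),
      conv α β γ (pathLift α β γ μ s t) (pathLift α β γ μ t u) W (x, y) =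
        pathLift α β γ μ s u W (x, y)) ∧
    (∃ p : LionsWord d → ℝ≥0∞, IsDualPair d α β γ p (fun W => q' / W.len)) ∧
    (min α β ≤ 1 → ∀ p : LionsWord d → ℝ≥0∞, IsDualPair d α β γ p (fun W => q' / W.len) →
      IsProbabilisticRoughPath α β γ p (fun W => q' / W.len) (supportMeasure μ)
        (pathLift α β γ μ)) := by
  have hmin : 0 < min α β := lt_min hα hβ
  have hγ' : min α β ≤ γ := hγ ▸ LionsWord.min_le_critGrade hd hα hβ
  have hγ0 : 0 ≤ γ := hmin.le.trans hγ'
  -- One-letter words force `γ ≥ α ∧ β` to be the relevant scale: the floor is then at least `1`.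
  have hq : 1 ≤ q' := by
    refine le_trans ?_ hq'
    have h : (1 : ℤ) ≤ ⌊γ / min α β⌋ := Int.le_floor.2 (by
      rw [Int.cast_one]; exact (one_le_div hmin).2 hγ')
    exact_mod_cast h
  refine ⟨iteratedIntegralRelations_wordInt,
    fun s t => isMcKeanVlasovCharacter_pathLift hα hβ hγ0 s t,
    fun s t u x W y => conv_pathLift hα hβ s t u W (x, y),
    exists_isDualPair hq fun W hW => LionsWord.len_le_of_mem_trunc hα hβ hq' hW,
    fun h1 p hp => isProbabilisticRoughPath_pathLift hα hβ hγ0 (zero_lt_one.trans_le hq) hμ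
      (fun W hW => LionsWord.grade_le_len hd hα hβ h1 (hγ ▸ hW)) hp⟩
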